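/- **Setting.** Let $\mathbb B$ be the closed Euclidean unit ball of $\mathbb R^d$ and let $D$ be a probability distribution (unknown to the learner) on nonempty compact action sets $\mathcal A\subset\mathbb B$. In each round $t=1,\dots,T$ the environment chooses a loss vector $y_t\in\mathbb B$, possibly at random and depending on everything that happened in the previous rounds; an action set $\mathcal A_t\sim D$ is drawn independently of the history and of $y_t$; the learner observes $\mathcal A_t$, draws an action $a_t\in\mathcal A_t$ without knowing $y_t$, and receives a loss $\ell_t\in[-1,1]$ whose conditional expectation, given the history, $y_t$, $\mathcal A_t$ and $a_t$, is $\langle a_t,y_t\rangle$. A policy is a map $\pi$ with $\pi(\mathcal A)\in\operatorname{conv}(\mathcal A)$ for every action set $\mathcal A$, and $$\mathrm{Reg}(\pi)=\mathbb E\Big[\sum_{t=1}^T\langle a_t,y_t\rangle-\sum_{t=1}^T\langle \pi(\mathcal A_t),y_t\rangle\Big],\qquad \mathrm{Reg}=\sup_\pi \mathrm{Reg}(\pi).$$ **Linear EXP4.** Let $\eta=\sqrt{\log T/T}$ and $\gamma=\min\{1,2d\eta\}$. Let $\Theta\subset\mathbb R^d$ be a finite set of at most $(3T)^d$ points such that every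 point of the ball of radius $T$ is within distance $1$ of $\Theta$; for $\theta\in\Theta$ let $\pi_\theta(\mathcal A)\in\operatorname{argmin}_{a\in\mathcal A}\langle a,\theta\rangle$ (ties broken arbitrarily). For a symmetric matrix $M$ let $M^{-1}$ be the inverse, or the Moore–Penrose inverse if $M$ is singular. For each $\mathcal A$ let $\nu_{\mathcal A}$ be a G-optimal design: among the probability measures $\nu$ on $\mathcal A$ whose matrix $G(\nu)=\mathbb E_{a\sim\nu}[aa^\top]$ has a range containing $\mathcal A$, it minimizes $\max_{a\in\mathcal A}a^\top G(\nu)^{-1}a$. In round $t$ the learner sets $$P_{t,\theta}\propto\exp\Big(-\eta\sum_{s<t}\hat\ell_{s,\theta}\Big)\ (\theta\in\Theta),\qquad \tilde p_t=(1-\gamma)\sum_{\theta\in\Theta}P_{t,\theta}\,\delta_{\pi_\theta(\mathcal A_t)}+\gamma\,\nu_{\mathcal A_t},$$ draws $a_t\sim\tilde p_t$, observes $\ell_t$, and forms $\hat\ell_{t,\theta}=\langle\pi_\theta(\mathcal A_t),\tilde H_t^{-1}a_t\ell_t\rangle$ with $\tilde H_t=\mathbb E_{a\sim\tilde p_t}[aa^\top]$.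 It uses no samples from $D$ other than the observed $\mathcal A_1,\dots,\mathcal A_t$. **Theorem.** A set $\Theta$ as above exists for all $d$ and all $T\ge1$. There is an absolute constant $C>0$ such that for all $d$, all $T\ge2$, all distributions $D$ and all environments as above, linear EXP4 satisfies $$\mathrm{Reg}\le C\,d\sqrt{T\log T}.$$ -/

import Mathlib

open MeasureTheory ProbabilityTheory TopologicalSpace
open scoped NNReal ENNReal Matrix

noncomputable section

namespace LinCB

/-- Actions, loss vectors and policy parameters live in `ℝᵈ` with the Euclidean norm. -/
abbrev Vec (d : ℕ) : Type := EuclideanSpace ℝ (Fin d)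

/-- A context is an action set: a nonempty compact subset of `ℝᵈ`. -/
abbrev Ctx (d : ℕ) : Type := NonemptyCompacts (Vec d)

/-- Random action sets are Borel measurable for the Hausdorff distance. -/
instance instMeasurableSpaceCtx (d : ℕ) : MeasurableSpace (Ctx d) := borel (Ctx d)

instance instBorelSpaceCtx (d : ℕ) : BorelSpace (Ctx d) := ⟨rfl⟩

/-! ### Policies -/

/-- A policy maps every action set to a point of its convex hull. -/
structure IsPolicy {d : ℕ} (π : Ctx d → Vec d) : Prop where
  measurable : Measurable π
  mem_convexHull : ∀ A : Ctx d, π A ∈ convexHull ℝ (A : Set (Vec d))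

/-- `greedy θ` is the policy `A ↦ argmin_{a ∈ A} ⟨a, θ⟩`, with an arbitrary (measurable) rule for
breaking ties. -/
structure IsGreedy {d : ℕ} (greedy : Vec d → Ctx d → Vec d) : Prop where
  measurable : ∀ θ, Measurable (greedy θ)
  mem : ∀ θ A, greedy θ A ∈ A
  le : ∀ θ A, ∀ b ∈ A, inner ℝ (greedy θ A) θ ≤ inner ℝ b θ

/-! ### Second moments, inverses and optimal designs -/

/-- `E_{a ∼ ν}[a aᵀ]`. -/
def secondMoment {d : ℕ} (ν : Measure (Vec d)) : Matrix (Fin d) (Fin d) ℝ :=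
  Matrix.of fun i j => ∫ a, a i * a j ∂ν

/-- The Moore–Penrose inverse of a symmetric matrix: nonzero eigenvalues are inverted and the
kernel is kept (recall `0⁻¹ = 0`). It is the inverse when the matrix is invertible. -/
def pinv {d : ℕ} (M : Matrix (Fin d) (Fin d) ℝ) : Matrix (Fin d) (Fin d) ℝ :=
  cfc (fun x : ℝ => x⁻¹) M

/-- The bilinear form `⟨u, M⁻¹ v⟩`. -/
def invForm {d : ℕ} (M : Matrix (Fin d) (Fin d) ℝ) (u v : Vec d) : ℝ :=
  inner ℝ u (Matrix.toEuclideanLin (pinv M) v)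

/-- A design on `A`: a probability measure on `A` whose second moment matrix is nondegenerate on
the span of `A`. -/
structure IsDesign {d : ℕ} (A : Ctx d) (ν : Measure (Vec d)) : Prop where
  prob : IsProbabilityMeasure ν
  supported : ν (A : Set (Vec d))ᶜ = 0
  span_le : Submodule.span ℝ (A : Set (Vec d)) ≤
    LinearMap.range (Matrix.toEuclideanLin (secondMoment ν))

/-- A G-optimal design on `A` minimizes `max_{a ∈ A} ‖a‖²_{G(ν)⁻¹}` over all designs `ν` on `A`,
where `G(ν) = E_{a ∼ ν}[a aᵀ]`. -/
def IsGOptimal {d : ℕ} (A : Ctx d) (ν : Measure (Vec d)) : Prop :=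
  IsDesign A ν ∧ ∀ ν' : Measure (Vec d), IsDesign A ν' →
    (⨆ a : A, invForm (secondMoment ν) a a) ≤ ⨆ a : A, invForm (secondMoment ν') a a

/-! ### Linear EXP4 -/

/-- The ingredients of linear EXP4: the finite set of parameters `Θ`, the greedy policies `π_θ`,
the exploration distributions `ν_A`, the learning rate `η` and the exploration weight `γ`. -/
structure Exp4 (d : ℕ) where
  Θ : Finset (Vec d)
  greedy : Vec d → Ctx d → Vec d
  explore : Kernel (Ctx d) (Vec d)
  η : ℝ
  γ : ℝ

namespace Exp4

variable {d : ℕ} (alg : Exp4 d)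

/-- Exponential weights `P_θ ∝ exp(-η L_θ)` over `θ ∈ Θ` for the cumulative estimates `L`. -/
def weight (L : Vec d → ℝ) (θ : Vec d) : ℝ :=
  Real.exp (-alg.η * L θ) / ∑ θ' ∈ alg.Θ, Real.exp (-alg.η * L θ')

/-- The distribution from which the action is drawn: with probability `1 - γ` the action
`π_θ(A)` for `θ ∼ P`, with probability `γ` an exploratory action. -/
def law (L : Vec d → ℝ) (A : Ctx d) : Measure (Vec d) :=
  ENNReal.ofReal (1 - alg.γ) •
      ∑ θ ∈ alg.Θ, ENNReal.ofReal (alg.weight L θ) • Measure.dirac (alg.greedy θ A)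
    + ENNReal.ofReal alg.γ • alg.explore A

/-- The loss estimate `⟨π_θ(A), H⁻¹ a ℓ⟩` of the policy `π_θ`, where `H` is the second moment matrix
of the distribution of the action. -/
def lossEst (L : Vec d → ℝ) (A : Ctx d) (a : Vec d) (ℓ : ℝ) (θ : Vec d) : ℝ :=
  invForm (secondMoment (alg.law L A)) (alg.greedy θ A) (ℓ • a)

/-- Cumulative loss estimates before round `t` (rounds are numbered from `0`), as a function of the
observed action sets, actions and losses. -/
def cumLoss (A : ℕ → Ctx d) (a : ℕ → Vec d) (ℓ : ℕ → ℝ) : ℕ → Vec d → ℝ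
  | 0 => fun _ => 0
  | t + 1 => fun θ =>
      cumLoss A a ℓ t θ + alg.lossEst (cumLoss A a ℓ t) (A t) (a t) (ℓ t) θ

/-- The distribution of the action in round `t`, given what the learner has observed. -/
def actionLaw (A : ℕ → Ctx d) (a : ℕ → Vec d) (ℓ : ℕ → ℝ) (t : ℕ) : Measure (Vec d) :=
  alg.law (alg.cumLoss A a ℓ t) (A t)

/-- The instance used with horizon `T`: `Θ` is a `1`-cover of the ball of radius `T` with at most
`(3T)ᵈ` points, exploration is by G-optimal designs, `η = √(log T / T)` and `γ = 2 d η`, capped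
at `1`. -/
structure IsTuned (T : ℕ) : Prop where
  cover : Metric.IsCover 1 (Metric.closedBall (0 : Vec d) T) (alg.Θ : Set (Vec d))
  card_le : alg.Θ.card ≤ (3 * T) ^ d
  greedy : IsGreedy alg.greedy
  explore : ∀ A, IsGOptimal A (alg.explore A)
  η_eq : alg.η = √(Real.log T / T)
  γ_eq : alg.γ = min 1 (2 * d * √(Real.log T / T))

end Exp4

/-! ### The interaction of the learner with the environment -/

section Interaction

variable {d : ℕ} {Ω : Type*} [mΩ : MeasurableSpace Ω]

/-- The history before round `t`: all that happened in rounds `s < t`, loss vectors included. -/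
abbrev past (ctx : ℕ → Ω → Ctx d) (y act : ℕ → Ω → Vec d) (loss : ℕ → Ω → ℝ) (t : ℕ) :
    MeasurableSpace Ω :=
  ⨆ s : Fin t, MeasurableSpace.comap (ctx s) inferInstance ⊔
    MeasurableSpace.comap (y s) inferInstance ⊔
    MeasurableSpace.comap (act s) inferInstance ⊔
    MeasurableSpace.comap (loss s) inferInstance

/-- The history before round `t` and the loss vector of round `t`. -/
abbrev beforeCtx (ctx : ℕ → Ω → Ctx d) (y act : ℕ → Ω → Vec d) (loss : ℕ → Ω → ℝ) (t : ℕ) :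
    MeasurableSpace Ω :=
  past ctx y act loss t ⊔ MeasurableSpace.comap (y t) inferInstance

/-- All that precedes the choice of the action in round `t`. -/
abbrev beforeAct (ctx : ℕ → Ω → Ctx d) (y act : ℕ → Ω → Vec d) (loss : ℕ → Ω → ℝ) (t : ℕ) :
    MeasurableSpace Ω :=
  beforeCtx ctx y act loss t ⊔ MeasurableSpace.comap (ctx t) inferInstance

/-- All that precedes the observation of the loss in round `t`. -/
abbrev beforeLoss (ctx : ℕ → Ω → Ctx d) (y act : ℕ → Ω → Vec d) (loss : ℕ → Ω → ℝ) (t : ℕ) :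
    MeasurableSpace Ω :=
  beforeAct ctx y act loss t ⊔ MeasurableSpace.comap (act t) inferInstance

/-- `T` rounds of linear EXP4 against an environment with context distribution `D`. The loss vector
`y t` may be random and may depend on the history; the action set is drawn from `D` independently
of the history and of `y t`; the action is drawn from the distribution prescribed by the
algorithm; the observed loss is an unbiased `[-1, 1]`-valued signal of `⟨act t, y t⟩`. -/
structure IsRun (alg : Exp4 d) (T : ℕ) (D : Measure (Ctx d)) (μ : Measure Ω)
    (ctx : ℕ → Ω → Ctx d) (y act : ℕ → Ω → Vec d) (loss : ℕ → Ω → ℝ) : Prop where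
  measurable_ctx : ∀ t, Measurable (ctx t)
  measurable_y : ∀ t, Measurable (y t)
  measurable_act : ∀ t, Measurable (act t)
  measurable_loss : ∀ t, Measurable (loss t)
  norm_y_le : ∀ t < T, ∀ᵐ ω ∂μ, ‖y t ω‖ ≤ 1
  ctx_law : ∀ t < T, μ.map (ctx t) = D
  ctx_indep : ∀ t < T, Indep (beforeCtx ctx y act loss t)
    (MeasurableSpace.comap (ctx t) inferInstance) μ
  act_law : ∀ t < T, ∀ S : Set (Vec d), MeasurableSet S →
    μ[(act t ⁻¹' S).indicator (fun _ => (1 : ℝ)) | beforeAct ctx y act loss t] =ᵐ[μ]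
      fun ω => (alg.actionLaw (fun s => ctx s ω) (fun s => act s ω) (fun s => loss s ω) t).real S
  abs_loss_le : ∀ t < T, ∀ᵐ ω ∂μ, |loss t ω| ≤ 1
  loss_mean : ∀ t < T,
    μ[loss t | beforeLoss ctx y act loss t] =ᵐ[μ] fun ω => inner ℝ (act t ω) (y t ω)

/-- The regret with respect to the policy `π`. -/
def regret (T : ℕ) (μ : Measure Ω) (ctx : ℕ → Ω → Ctx d) (y act : ℕ → Ω → Vec d)
    (π : Ctx d → Vec d) : ℝ :=
  ∫ ω, (∑ t ∈ Finset.range T, inner ℝ (act t ω) (y t ω) -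
    ∑ t ∈ Finset.range T, inner ℝ (π (ctx t ω)) (y t ω)) ∂μ

end Interaction

end LinCB

end

/-! In each round the action set is independent of the history and of `y t`, so the expected total
loss of a fixed policy `π` is `E⟨π(A), Y⟩` with `A ∼ D` and `Y = ∑ E[y t]`, a single vector of norm
at most `T`. The greedy policy for `Y` is therefore a best policy, and the greedy policy for a point
of the cover within distance `1` of `Y` loses at most `2` more over all rounds
(`IsRun.exists_greedy_le`). The infinite class of policies thus reduces to `|Θ| ≤ (3T)ᵈ` experts
with `log |Θ| = O(d log T)`.

Against these experts the regret bound of exponential weights is applied to the loss estimates,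
which needs three facts about one round, all conditional on the action set actually observed. Bias:
exploration puts every action into the range of the second moment matrix `H`, so the estimates are
unbiased (`integral_invForm_mul_inner`). Range: `H ≥ γ G(ν)`, and a G-optimal design satisfies `aᵀ
G(ν)⁻¹ a ≤ 2d`, so the estimates are at most `2d/γ`, which is `1/η` when `γ = 2dη`
(`invForm_law_self_le`). Variance: the weighted second moment, multiplied by `1 - γ`, is at most
`tr(H⁻¹ H) ≤ d` (`sum_weight_mul_invForm_le`).

Together the regret is at most `log |Θ| / η + η T d + 2 γ T + 2`, and every term is `O(d √(T log
T))`. If `2dη ≥ 1`, then `T` itself is of that order and the trivial bound `2T` suffices.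

The bound `2d` for designs is a weak form of the Kiefer–Wolfowitz theorem: a design whose
determinant is within a constant factor of the supremum already has it, so no maximizer is needed.
-/

noncomputable section

namespace LinCB

/-! ### Moore–Penrose inverses and the forms they define -/

section PseudoInverse

variable {d : ℕ} {M : Matrix (Fin d) (Fin d) ℝ}

theorem isHermitian_pinv (M : Matrix (Fin d) (Fin d) ℝ) : (pinv M).IsHermitian :=
  cfc_predicate (R := ℝ) (fun x : ℝ => x⁻¹) M

/-- The spectrum is finite, so every function is continuous on it and the Moore–Penrose identities
reduce to scalar ones such as `x * (x⁻¹ * x) = x`, valid at `0` because `0⁻¹ = 0`. -/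
theorem pinv_mul_self_eq_cfc (hM : M.IsHermitian) :
    pinv M * M = cfc (fun x : ℝ => x⁻¹ * x) M := by
  have hs : IsSelfAdjoint M := hM
  have hc : ∀ f : ℝ → ℝ, ContinuousOn f (spectrum ℝ M) := fun f =>
    (Matrix.finite_real_spectrum (A := M)).continuousOn f
  conv_lhs => rw [pinv]
  nth_rw 2 [← cfc_id' ℝ M]
  rw [← cfc_mul _ _ _ (hc _) (hc _)]

theorem mul_pinv_mul_self (hM : M.IsHermitian) : M * pinv M * M = M := by
  have hs : IsSelfAdjoint M := hM
  have hc : ∀ f : ℝ → ℝ, ContinuousOn f (spectrum ℝ M) := fun f =>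
    (Matrix.finite_real_spectrum (A := M)).continuousOn f
  rw [mul_assoc, pinv_mul_self_eq_cfc hM]
  nth_rw 1 [← cfc_id' ℝ M]
  rw [← cfc_mul _ _ _ (hc _) (hc _)]
  conv_rhs => rw [← cfc_id' ℝ M]
  congr 1
  ext x
  by_cases hx : x = 0 <;> simp [hx]

theorem pinv_mul_self_mul_pinv (hM : M.IsHermitian) : pinv M * M * pinv M = pinv M := by
  have hs : IsSelfAdjoint M := hM
  have hc : ∀ f : ℝ → ℝ, ContinuousOn f (spectrum ℝ M) := fun f =>
    (Matrix.finite_real_spectrum (A := M)).continuousOn f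
  rw [pinv_mul_self_eq_cfc hM, pinv, ← cfc_mul _ _ _ (hc _) (hc _)]
  congr 1
  ext x
  by_cases hx : x = 0 <;> simp [hx]

/-- The matrix `E = M⁻¹ M` is an orthogonal projection, so `E i i = ∑ j, E i j ^ 2 ≥ E i i ^ 2` and
each diagonal entry is at most `1`. -/
theorem trace_pinv_mul_self_le (hM : M.IsHermitian) : (pinv M * M).trace ≤ d := by
  have hE : (pinv M * M)ᴴ = pinv M * M := by
    rw [pinv_mul_self_eq_cfc hM]
    exact cfc_predicate (R := ℝ) (fun x : ℝ => x⁻¹ * x) M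
  have hEE : pinv M * M * (pinv M * M) = pinv M * M := by
    rw [← mul_assoc, pinv_mul_self_mul_pinv hM]
  generalize pinv M * M = E at hE hEE
  have key : ∀ i, E i i ≤ 1 := fun i => by
    have h1 : E i i = ∑ j, E i j * E i j := by
      conv_lhs => rw [← hEE, Matrix.mul_apply]
      refine Finset.sum_congr rfl fun j _ => ?_
      conv_lhs => rw [← hE]
      have : E j i = E i j := by
        conv_lhs => rw [← hE]
        simp
      simp [this]
    have h2 : E i i * E i i ≤ ∑ j, E i j * E i j :=
      Finset.single_le_sum (f := fun j => E i j * E i j) (fun j _ => mul_self_nonneg _)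
        (Finset.mem_univ i)
    nlinarith
  calc E.trace = ∑ i, E i i := rfl
    _ ≤ ∑ _i : Fin d, (1 : ℝ) := Finset.sum_le_sum fun i _ => key i
    _ = d := by simp

theorem inner_toEuclideanLin_comm (hM : M.IsHermitian) (u v : Vec d) :
    inner ℝ (Matrix.toEuclideanLin M u) v = inner ℝ u (Matrix.toEuclideanLin M v) :=
  (Matrix.isSymmetric_toEuclideanLin_iff.2 hM) u v

theorem toEuclideanLin_mul_apply (M N : Matrix (Fin d) (Fin d) ℝ) (v : Vec d) :
    Matrix.toEuclideanLin (M * N) v = Matrix.toEuclideanLin M (Matrix.toEuclideanLin N v) := by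
  simp [Matrix.toLpLin_apply]

/-- On the range of `M`, the form `⟨u, M⁻¹ v⟩` is computed from any preimage of `u`. -/
theorem invForm_apply_of_mem_range (hM : M.IsHermitian) (x : Vec d) {v : Vec d}
    (hv : v ∈ LinearMap.range (Matrix.toEuclideanLin M)) :
    invForm M (Matrix.toEuclideanLin M x) v = inner ℝ x v := by
  obtain ⟨z, rfl⟩ := hv
  rw [invForm, inner_toEuclideanLin_comm hM, ← toEuclideanLin_mul_apply,
    ← toEuclideanLin_mul_apply, mul_pinv_mul_self hM]

theorem invForm_comm (M : Matrix (Fin d) (Fin d) ℝ) (u v : Vec d) :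
    invForm M u v = invForm M v u := by
  rw [invForm, ← inner_toEuclideanLin_comm (isHermitian_pinv M), real_inner_comm, invForm]

theorem invForm_eq_inner_left (M : Matrix (Fin d) (Fin d) ℝ) (u v : Vec d) :
    invForm M u v = inner ℝ (Matrix.toEuclideanLin (pinv M) u) v := by
  rw [invForm, inner_toEuclideanLin_comm (isHermitian_pinv M)]

theorem invForm_self_eq (hM : M.IsHermitian) (u : Vec d) :
    invForm M u u = inner ℝ (Matrix.toEuclideanLin (pinv M) u)
      (Matrix.toEuclideanLin M (Matrix.toEuclideanLin (pinv M) u)) := by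
  rw [inner_toEuclideanLin_comm (isHermitian_pinv M), ← toEuclideanLin_mul_apply,
    ← toEuclideanLin_mul_apply, pinv_mul_self_mul_pinv hM, invForm]

theorem inner_toEuclideanLin_self_nonneg (hM : M.PosSemidef) (x : Vec d) :
    0 ≤ inner ℝ x (Matrix.toEuclideanLin M x) := by
  have h := hM.dotProduct_mulVec_nonneg (WithLp.ofLp x)
  rw [EuclideanSpace.inner_eq_star_dotProduct]
  simpa [Matrix.toLpLin_apply, dotProduct_comm] using h

theorem invForm_self_nonneg (hM : M.PosSemidef) (u : Vec d) : 0 ≤ invForm M u u := by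
  rw [invForm_self_eq hM.1]
  exact inner_toEuclideanLin_self_nonneg hM _

/-- Cauchy–Schwarz inequality for a positive semidefinite matrix, in additive form. -/
theorem two_mul_inner_toEuclideanLin_le (hM : M.PosSemidef) (x z : Vec d) :
    2 * inner ℝ x (Matrix.toEuclideanLin M z) ≤
      inner ℝ x (Matrix.toEuclideanLin M x) + inner ℝ z (Matrix.toEuclideanLin M z) := by
  have h := inner_toEuclideanLin_self_nonneg hM (x - z)
  have h2 : inner ℝ z (Matrix.toEuclideanLin M x) = inner ℝ x (Matrix.toEuclideanLin M z) := by
    rw [real_inner_comm, inner_toEuclideanLin_comm hM.1]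
  simp only [map_sub, inner_sub_left, inner_sub_right] at h
  linarith

/-- Additive Cauchy–Schwarz at `M⁻¹ u` and `M⁻¹ v`, then at `M⁻¹ (-u)` for the other sign. No range
condition is needed, since `M⁻¹ M M⁻¹ = M⁻¹`. -/
theorem abs_invForm_le (hM : M.PosSemidef) {u v : Vec d} {K : ℝ}
    (hu : invForm M u u ≤ K) (hv : invForm M v v ≤ K) : |invForm M u v| ≤ K := by
  have key : ∀ w : Vec d, invForm M w w ≤ K → invForm M w v ≤ K := fun w hw => by
    have h := two_mul_inner_toEuclideanLin_le hM (Matrix.toEuclideanLin (pinv M) w)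
      (Matrix.toEuclideanLin (pinv M) v)
    rw [← invForm_self_eq hM.1, ← invForm_self_eq hM.1,
      inner_toEuclideanLin_comm (isHermitian_pinv M), ← toEuclideanLin_mul_apply,
      ← toEuclideanLin_mul_apply, pinv_mul_self_mul_pinv hM.1] at h
    change 2 * invForm M w v ≤ _ at h
    linarith
  have hneg : invForm M (-u) v = -invForm M u v := by simp [invForm]
  refine abs_le.2 ⟨?_, key u hu⟩
  have := key (-u) (by simpa [invForm] using hu)
  linarith

/-- A larger matrix has a smaller inverse form on the range of the smaller one. -/
theorem invForm_self_le_of_le {N : Matrix (Fin d) (Fin d) ℝ} (hM : M.PosSemidef)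
    (hN : N.PosSemidef) {c : ℝ} (hc : 0 < c)
    (hle : ∀ x : Vec d, c * inner ℝ x (Matrix.toEuclideanLin N x) ≤
      inner ℝ x (Matrix.toEuclideanLin M x))
    {u : Vec d} (huN : u ∈ LinearMap.range (Matrix.toEuclideanLin N))
    (huM : u ∈ LinearMap.range (Matrix.toEuclideanLin M)) :
    invForm M u u ≤ invForm N u u / c := by
  obtain ⟨x, hx⟩ := huM
  obtain ⟨z, hz⟩ := huN
  have h1 : invForm M u u = inner ℝ x u := by
    nth_rw 1 [← hx]; exact invForm_apply_of_mem_range hM.1 x ⟨x, hx⟩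
  have h2 : invForm N u u = inner ℝ z u := by
    nth_rw 1 [← hz]; exact invForm_apply_of_mem_range hN.1 z ⟨z, hz⟩
  have h3 := hle x
  rw [hx] at h3
  -- With `u = M x = N z` this reads `2c⟨x,u⟩ ≤ c²⟨x,Nx⟩ + ⟨z,u⟩ ≤ c⟨x,u⟩ + ⟨z,u⟩`, hence `c⟨x,u⟩ ≤
  -- ⟨z,u⟩`.
  have h4 := two_mul_inner_toEuclideanLin_le hN (c • x) z
  simp only [map_smul, inner_smul_left, inner_smul_right, hz] at h4
  rw [h1, h2, le_div_iff₀ hc]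
  simp at h4
  nlinarith

/-- By duality it suffices that `ker M ≤ ker N`: if `M x = 0` then `⟨x, N x⟩ = 0`, which forces `N x
= 0` for positive semidefinite `N`. -/
theorem range_toEuclideanLin_le_of_le {N : Matrix (Fin d) (Fin d) ℝ} (hM : M.PosSemidef)
    (hN : N.PosSemidef) {c : ℝ} (hc : 0 < c)
    (hle : ∀ x : Vec d, c * inner ℝ x (Matrix.toEuclideanLin N x) ≤
      inner ℝ x (Matrix.toEuclideanLin M x)) :
    LinearMap.range (Matrix.toEuclideanLin N) ≤ LinearMap.range (Matrix.toEuclideanLin M) := by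
  have hsM := Matrix.isSymmetric_toEuclideanLin_iff.2 hM.1
  have hsN := Matrix.isSymmetric_toEuclideanLin_iff.2 hN.1
  rw [← Submodule.orthogonal_le_orthogonal_iff, hsM.orthogonal_range, hsN.orthogonal_range]
  intro x hx
  rw [LinearMap.mem_ker] at hx ⊢
  have h := hle x
  rw [hx, inner_zero_right] at h
  have h0 : inner ℝ x (Matrix.toEuclideanLin N x) = 0 :=
    le_antisymm (by nlinarith) (inner_toEuclideanLin_self_nonneg hN x)
  set w := Matrix.toEuclideanLin N x with hw
  by_contra hne
  have hpos : 0 < inner ℝ w w := real_inner_self_pos.2 hne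
  have h5 : inner ℝ w (Matrix.toEuclideanLin N x) = inner ℝ w w := by rw [← hw]
  set q := inner ℝ w (Matrix.toEuclideanLin N w) with hq
  have hq0 : 0 ≤ q := inner_toEuclideanLin_self_nonneg hN w
  -- For `p = ⟨w,w⟩` and any factor `s` this gives `2 s p ≤ s² q`. With `s = p / (q + 1)` one has `s
  -- q ≤ p`, which contradicts `s p > 0`; the `+ 1` avoids dividing by `0`.
  have h6 := two_mul_inner_toEuclideanLin_le hN ((inner ℝ w w / (q + 1)) • w) x
  simp only [map_smul, inner_smul_left, inner_smul_right, h0, ← hq, ← hw] at h6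
  simp only [conj_trivial] at h6
  set p := inner ℝ w w
  have h7 : p / (q + 1) * p * 2 ≤ p / (q + 1) * (p / (q + 1) * q) := by linarith
  have h8 : 0 < p / (q + 1) := by positivity
  have h9 : p / (q + 1) * q ≤ p := by
    rw [div_mul_eq_mul_div, div_le_iff₀ (by positivity)]; nlinarith
  nlinarith

end PseudoInverse

/-! ### Covering the ball by few points -/

section Cover

open Metric Module Set

open scoped Function in
-- Volume comparison: the balls of radius `1/2` around the points are disjoint and lie in the ball
-- of radius `T + 1/2`.
theorem card_le_of_isSeparated {d T : ℕ} (s : Finset (Vec d)) (hs : ∀ c ∈ s, ‖c‖ ≤ T)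
    (h : ∀ c ∈ s, ∀ e ∈ s, c ≠ e → 1 ≤ ‖c - e‖) : s.card ≤ (2 * T + 1) ^ d := by
  let μ : Measure (Vec d) := volume
  let δ : ℝ := (1 : ℝ) / 2
  let ρ : ℝ := T + (1 : ℝ) / 2
  have ρpos : 0 < ρ := by positivity
  set A := ⋃ c ∈ s, ball (c : Vec d) δ with hA
  have D : Set.Pairwise (s : Set (Vec d)) (Disjoint on fun c => ball (c : Vec d) δ) := by
    rintro c hc e he hce
    apply ball_disjoint_ball
    rw [dist_eq_norm]
    convert! h c hc e he hce
    norm_num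
  have A_subset : A ⊆ ball (0 : Vec d) ρ := by
    refine iUnion₂_subset fun x hx => ball_subset_ball' ?_
    rw [dist_zero_right]
    have := hs x hx
    simp only [δ, ρ]
    linarith
  have I : (s.card : ℝ≥0∞) * ENNReal.ofReal (δ ^ d) * μ (ball 0 1) ≤
      ENNReal.ofReal (ρ ^ d) * μ (ball 0 1) := by
    calc
      (s.card : ℝ≥0∞) * ENNReal.ofReal (δ ^ d) * μ (ball 0 1) = μ A := by
        rw [hA, measure_biUnion_finset D fun c _ => measurableSet_ball]
        have I : 0 < δ := by norm_num [δ]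
        simp only [μ, Measure.addHaar_ball_of_pos _ _ I, finrank_euclideanSpace_fin,
          Finset.sum_const, nsmul_eq_mul, mul_assoc]
      _ ≤ μ (ball (0 : Vec d) ρ) := measure_mono A_subset
      _ = ENNReal.ofReal (ρ ^ d) * μ (ball 0 1) := by
        simp only [μ, Measure.addHaar_ball_of_pos _ _ ρpos, finrank_euclideanSpace_fin]
  have J : (s.card : ℝ≥0∞) * ENNReal.ofReal (δ ^ d) ≤ ENNReal.ofReal (ρ ^ d) :=
    (ENNReal.mul_le_mul_iff_left (measure_ball_pos _ _ zero_lt_one).ne' measure_ball_lt_top.ne).1 I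
  have K : (s.card : ℝ) ≤ (2 * T + 1 : ℝ) ^ d := by
    have := ENNReal.toReal_mono (by simp) J
    rw [ENNReal.toReal_mul, ENNReal.toReal_ofReal (by positivity),
      ENNReal.toReal_ofReal (by positivity), ENNReal.toReal_natCast,
      ← le_div_iff₀ (by positivity), ← div_pow] at this
    have hρδ : ρ / δ = 2 * T + 1 := by
      simp only [δ, ρ]
      ring
    rwa [hρδ] at this
  exact_mod_cast K

/-- A maximal `1`-separated subset of the ball is a `1`-cover, and `2T + 1 ≤ 3T` because `T ≥ 1`. -/
theorem exists_isCover_closedBall (d T : ℕ) (hT : 1 ≤ T) : ∃ Θ : Finset (Vec d),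
    IsCover 1 (closedBall (0 : Vec d) T) (Θ : Set (Vec d)) ∧ Θ.card ≤ (3 * T) ^ d := by
  have key : ∀ C : Set (Vec d), C ⊆ closedBall 0 T → IsSeparated (1 : ℝ≥0) C →
      C.encard ≤ ((3 * T) ^ d : ℕ) := fun C hC hsep => by
    by_contra! hlt
    -- `C` might be infinite, so the volume bound is applied to a finite subset with one point too
    -- many.
    obtain ⟨t, htC, ht⟩ := Set.exists_subset_encard_eq (Order.add_one_le_of_lt hlt)
    have hfin : t.Finite := Set.finite_of_encard_eq_coe (k := (3 * T) ^ d + 1) (by simpa using ht)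
    have h1 : hfin.toFinset.card ≤ (2 * T + 1) ^ d := by
      refine card_le_of_isSeparated _ (fun c hc => ?_) fun c hc e he hce => ?_
      · simpa using hC (htC (hfin.mem_toFinset.1 hc))
      · have := hsep (htC (hfin.mem_toFinset.1 hc)) (htC (hfin.mem_toFinset.1 he)) hce
        simp only [edist_dist, dist_eq_norm] at this
        have h := (ENNReal.toReal_lt_toReal (by simp) (by simp)).2 this
        rw [ENNReal.toReal_ofReal (by positivity)] at h
        simpa using h.le
    have h2 : (2 * T + 1) ^ d ≤ (3 * T) ^ d := Nat.pow_le_pow_left (by omega) d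
    rw [hfin.encard_eq_coe_toFinset_card] at ht
    have h3 : hfin.toFinset.card = (3 * T) ^ d + 1 := by exact_mod_cast ht
    omega
  have hpack : packingNumber 1 (closedBall (0 : Vec d) T) ≤ ((3 * T) ^ d : ℕ) :=
    iSup_le fun C => iSup_le fun hC => iSup_le fun hsep => key C hC hsep
  have hne : packingNumber 1 (closedBall (0 : Vec d) T) ≠ ⊤ :=
    ne_top_of_le_ne_top (ENat.natCast_ne_top _) hpack
  obtain ⟨C, hC⟩ : ∃ C : Finset (Vec d), (C : Set (Vec d)) =
      maximalSeparatedSet 1 (closedBall (0 : Vec d) T) := by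
    have : (maximalSeparatedSet 1 (closedBall (0 : Vec d) T)).Finite := by
      rw [← Set.encard_ne_top_iff, encard_maximalSeparatedSet hne]
      exact hne
    exact ⟨this.toFinset, this.coe_toFinset⟩
  refine ⟨C, hC ▸ isCover_maximalSeparatedSet hne, ?_⟩
  have := encard_maximalSeparatedSet hne
  rw [← hC, Set.encard_coe_eq_coe_finsetCard] at this
  exact_mod_cast this ▸ hpack

end Cover

/-! ### Near-optimal designs -/

section Design

variable {d : ℕ}

/-- The rank one matrix `v vᵀ`. -/
def outer (v : Vec d) : Matrix (Fin d) (Fin d) ℝ := Matrix.vecMulVec v.ofLp v.ofLp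

theorem outer_apply (v : Vec d) (i j : Fin d) : outer v i j = v i * v j := rfl

theorem toEuclideanLin_outer (v x : Vec d) :
    Matrix.toEuclideanLin (outer v) x = (inner ℝ v x : ℝ) • v := by
  ext i
  simp only [Matrix.toLpLin_apply, Matrix.mulVec, dotProduct, outer_apply, PiLp.inner_apply,
    PiLp.smul_apply, smul_eq_mul, Finset.sum_mul]
  refine Finset.sum_congr rfl fun j _ => ?_
  simp
  ring

/-- The uniform average over a basis taken from `S` is `d⁻¹ BᵀB`, with `B` the invertible matrix
whose rows are the basis. -/
theorem exists_det_pos_mem_convexHull_outer (hd : 0 < d) {S : Set (Vec d)}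
    (hspan : Submodule.span ℝ S = ⊤) : ∃ M ∈ convexHull ℝ (outer '' S), 0 < M.det := by
  obtain ⟨f, hfS, -, hli⟩ := Submodule.exists_fun_fin_finrank_span_eq ℝ S
  have hr : Module.finrank ℝ (Submodule.span ℝ S) = d := by rw [hspan, finrank_top]; simp
  obtain ⟨b, hbS, hb⟩ : ∃ b : Fin d → Vec d, (∀ i, b i ∈ S) ∧ LinearIndependent ℝ b :=
    ⟨fun i => f (Fin.cast hr.symm i), fun i => hfS _,
      hli.comp _ (Fin.cast_injective hr.symm)⟩
  let B : Matrix (Fin d) (Fin d) ℝ := Matrix.of fun i => (b i).ofLp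
  have hB : IsUnit B := by
    rw [← Matrix.linearIndependent_rows_iff_isUnit]
    exact hb.map' (WithLp.linearEquiv 2 ℝ (Fin d → ℝ)).toLinearMap (LinearEquiv.ker _)
  have hdpos : (0 : ℝ) < d := by exact_mod_cast hd
  refine ⟨∑ i, (d : ℝ)⁻¹ • outer (b i), ?_, ?_⟩
  · refine (convex_convexHull ℝ _).sum_mem (fun i _ => by positivity) ?_
      fun i _ => subset_convexHull ℝ _ ⟨b i, hbS i, rfl⟩
    simp [hdpos.ne']
  · have h : ∑ i, (d : ℝ)⁻¹ • outer (b i) = (d : ℝ)⁻¹ • (Bᵀ * B) := by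
      ext i j
      simp [Matrix.sum_apply, Matrix.mul_apply, outer_apply, Finset.mul_sum, B]
    rw [h, Matrix.det_smul, Matrix.det_mul, Matrix.det_transpose]
    have : B.det ≠ 0 := ((Matrix.isUnit_iff_isUnit_det B).1 hB).ne_zero
    have h2 : 0 < B.det * B.det := mul_self_pos.2 this
    positivity

theorem posSemidef_of_mem_convexHull_outer {S : Set (Vec d)} {M : Matrix (Fin d) (Fin d) ℝ}
    (hM : M ∈ convexHull ℝ (outer '' S)) : M.PosSemidef := by
  have hconv : Convex ℝ {M : Matrix (Fin d) (Fin d) ℝ | M.PosSemidef} :=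
    fun M hM N hN a b ha hb _ => (hM.smul ha).add (hN.smul hb)
  refine convexHull_min ?_ hconv hM
  rintro _ ⟨v, -, rfl⟩
  have := Matrix.posSemidef_vecMulVec_self_star v.ofLp
  simpa [outer] using this

theorem toEuclideanLin_mem_of_mem_convexHull_outer {S : Set (Vec d)}
    {M : Matrix (Fin d) (Fin d) ℝ} (hM : M ∈ convexHull ℝ (outer '' S)) {V : Submodule ℝ (Vec d)}
    (hV : S ⊆ V) (x : Vec d) : Matrix.toEuclideanLin M x ∈ V := by
  have hconv : Convex ℝ {M : Matrix (Fin d) (Fin d) ℝ | Matrix.toEuclideanLin M x ∈ V} :=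
    fun M hM N hN a b _ _ _ => by
      simp only [Set.mem_ofPred_eq, map_add, map_smul, LinearMap.add_apply, LinearMap.smul_apply]
      exact V.add_mem (V.smul_mem _ hM) (V.smul_mem _ hN)
  refine convexHull_min ?_ hconv hM
  rintro _ ⟨v, hv, rfl⟩
  simp only [Set.mem_ofPred_eq, toEuclideanLin_outer]
  exact V.smul_mem _ (hV hv)

/-- Only finiteness matters: it makes the supremum of the determinants over the hull meaningful. -/
theorem abs_det_le_of_mem_convexHull_outer {S : Set (Vec d)} {R : ℝ} (hR : ∀ v ∈ S, ‖v‖ ≤ R)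
    {M : Matrix (Fin d) (Fin d) ℝ} (hM : M ∈ convexHull ℝ (outer '' S)) :
    |M.det| ≤ d.factorial * (R ^ 2) ^ d := by
  have hconv : Convex ℝ
      {M : Matrix (Fin d) (Fin d) ℝ | ∀ i j, M i j ∈ Set.Icc (-R ^ 2) (R ^ 2)} := by
    intro M hM N hN a b ha hb hab i j
    exact (convex_Icc (-R ^ 2) (R ^ 2)) (hM i j) (hN i j) ha hb hab
  have h : ∀ i j, M i j ∈ Set.Icc (-R ^ 2) (R ^ 2) := by
    refine convexHull_min ?_ hconv hM
    rintro _ ⟨v, hv, rfl⟩ i j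
    have hi : |v i| ≤ R := (PiLp.norm_apply_le v i).trans (hR v hv)
    have hj : |v j| ≤ R := (PiLp.norm_apply_le v j).trans (hR v hv)
    rw [outer_apply, Set.mem_Icc, ← abs_le, abs_mul, sq]
    exact mul_le_mul hi hj (abs_nonneg _) ((abs_nonneg _).trans hi)
  have := Matrix.det_le (A := M) (abv := AbsoluteValue.abs) (x := R ^ 2) fun i j => abs_le.2 (h i j)
  simpa using this

/-- Matrix determinant lemma for a rank one update. -/
theorem det_add_smul_outer {M : Matrix (Fin d) (Fin d) ℝ} (hM : IsUnit M.det) (s : ℝ) (v : Vec d) :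
    (M + s • outer v).det = M.det * (1 + s * (v.ofLp ⬝ᵥ M⁻¹ *ᵥ v.ofLp)) := by
  have h : M + s • outer v = M * (1 + Matrix.replicateCol Unit (s • M⁻¹ *ᵥ v.ofLp) *
      Matrix.replicateRow Unit v.ofLp) := by
    rw [mul_add, mul_one, ← Matrix.vecMulVec_eq, Matrix.mul_vecMulVec, Matrix.mulVec_smul,
      Matrix.mulVec_mulVec, Matrix.mul_nonsing_inv _ hM, Matrix.one_mulVec, Matrix.smul_vecMulVec,
      outer]
  rw [h, Matrix.det_mul, Matrix.det_one_add_replicateCol_mul_replicateRow, dotProduct_smul,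
    smul_eq_mul]

/-- An almost D-optimal design is almost G-optimal. -/
theorem exists_mem_convexHull_outer_dotProduct_inv_le (hd : 0 < d) {S : Set (Vec d)} {R : ℝ}
    (hR : ∀ v ∈ S, ‖v‖ ≤ R) (hspan : Submodule.span ℝ S = ⊤) :
    ∃ M ∈ convexHull ℝ (outer '' S), 0 < M.det ∧
      ∀ v ∈ S, v.ofLp ⬝ᵥ M⁻¹ *ᵥ v.ofLp ≤ 2 * d := by
  obtain ⟨M₀, hM₀, hdet₀⟩ := exists_det_pos_mem_convexHull_outer hd hspan
  set K := convexHull ℝ (outer '' S)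
  have hbdd : BddAbove (Matrix.det '' K) := ⟨d.factorial * (R ^ 2) ^ d, by
    rintro _ ⟨M, hM, rfl⟩
    exact (le_abs_self _).trans (abs_det_le_of_mem_convexHull_outer hR hM)⟩
  set σ := sSup (Matrix.det '' K)
  have hσ : 0 < σ := hdet₀.trans_le (le_csSup hbdd ⟨M₀, hM₀, rfl⟩)
  -- A determinant within a factor `6/5` of the supremum replaces a maximizer, so attainment is not
  -- needed.
  obtain ⟨_, ⟨M, hM, rfl⟩, hMσ⟩ := exists_lt_of_lt_csSup (s := Matrix.det '' K) (b := σ / (6 / 5))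
    ⟨_, M₀, hM₀, rfl⟩ (div_lt_self hσ (by norm_num))
  have hMpos : 0 < M.det := lt_trans (by positivity) hMσ
  refine ⟨M, hM, hMpos, fun v hv => ?_⟩
  have hdpos : (0 : ℝ) < d := by exact_mod_cast hd
  -- Moving `M` towards `v vᵀ` multiplies the determinant by `(1 + s x) / (1 + s)ᵈ`, at most `6/5`
  -- by the choice of `M`. Since `(1 + s)ᵈ ≤ √e ≤ 33/20` and `6/5 · 33/20 < 2`, it follows that `s x
  -- ≤ 1`, that is, `x ≤ 2d`.
  set s : ℝ := 1 / (2 * d) with hs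
  have hspos : 0 < s := by positivity
  set x := v.ofLp ⬝ᵥ M⁻¹ *ᵥ v.ofLp
  have hmem : (1 + s)⁻¹ • (M + s • outer v) ∈ K := by
    rw [smul_add, smul_smul]
    refine convex_convexHull ℝ _ hM (subset_convexHull ℝ _ ⟨v, hv, rfl⟩) (by positivity)
      (by positivity) ?_
    field_simp
  have h1 : ((1 + s)⁻¹ • (M + s • outer v)).det ≤ σ := le_csSup hbdd ⟨_, hmem, rfl⟩
  rw [Matrix.det_smul, det_add_smul_outer hMpos.ne'.isUnit, Fintype.card_fin, inv_pow,
    inv_mul_le_iff₀ (by positivity)] at h1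
  have h2 : (1 + s) ^ d ≤ 33 / 20 := by
    have h3 : (1 + s) ^ d ≤ Real.exp s ^ d :=
      pow_le_pow_left₀ (by positivity) (by linarith [Real.add_one_le_exp s]) d
    have h4 : Real.exp s ^ d = Real.exp (1 / 2) := by
      rw [← Real.exp_nat_mul, hs]
      congr 1
      field_simp
    have h5 : Real.exp (1 / 2) * Real.exp (1 / 2) = Real.exp 1 := by
      rw [← Real.exp_add]; norm_num
    have h6 := Real.exp_one_lt_d9
    have h7 := Real.exp_pos (1 / 2)
    rw [h4] at h3
    nlinarith
  have h8 : M.det * (1 + s * x) ≤ M.det * 2 := by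
    have : σ ≤ M.det * (6 / 5) := by rw [div_lt_iff₀ (by norm_num)] at hMσ; exact hMσ.le
    nlinarith [mul_le_mul_of_nonneg_right h2 hσ.le]
  have h9 : s * x ≤ 1 := by linarith [le_of_mul_le_mul_left h8 hMpos]
  rw [hs, div_mul_eq_mul_div, one_mul, div_le_one (by positivity)] at h9
  exact h9

theorem secondMoment_sum_dirac {ι : Type*} [Fintype ι] (w : ι → ℝ) (hw : ∀ i, 0 ≤ w i)
    (a : ι → Vec d) :
    secondMoment (∑ i, ENNReal.ofReal (w i) • Measure.dirac (a i)) = ∑ i, w i • outer (a i) := by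
  ext i j
  have hinteg : ∀ k : ι, Integrable (fun x : Vec d => x i * x j)
      (ENNReal.ofReal (w k) • Measure.dirac (a k)) := fun k =>
    (integrable_dirac (by simp [ENNReal.mul_lt_top])).smul_measure (by simp)
  rw [secondMoment, Matrix.of_apply, integral_finsetSum_measure fun k _ => hinteg k,
    Matrix.sum_apply]
  refine Finset.sum_congr rfl fun k _ => ?_
  rw [integral_smul_measure, integral_dirac, ENNReal.toReal_ofReal (hw k)]
  rfl

theorem exists_measure_secondMoment_eq {S : Set (Vec d)} {M : Matrix (Fin d) (Fin d) ℝ}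
    (hM : M ∈ convexHull ℝ (outer '' S)) :
    ∃ ν : Measure (Vec d), IsProbabilityMeasure ν ∧ ν Sᶜ = 0 ∧ secondMoment ν = M := by
  obtain ⟨ι, _, w, z, hw, hw1, hz, rfl⟩ := mem_convexHull_iff_exists_fintype.1 hM
  choose a haS haz using hz
  refine ⟨∑ i, ENNReal.ofReal (w i) • Measure.dirac (a i), ⟨?_⟩, ?_, ?_⟩
  · simp [← ENNReal.ofReal_sum_of_nonneg fun i _ => hw i, hw1]
  · simp [haS]
  · rw [secondMoment_sum_dirac w hw]
    simp [haz]

/-- If `A` does not span, it is enlarged by the unit ball of `Vᗮ`, where `V` is its span. A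
near-optimal matrix for the enlarged set splits as `w M₁ + w' W` with `M₁` acting into `V` and `W`
into `Vᗮ`; the part `M₁` comes from a design on `A` and inherits the bound. -/
theorem exists_isDesign_invForm_le (A : Ctx d) :
    ∃ ν : Measure (Vec d), IsDesign A ν ∧ ∀ a ∈ A, invForm (secondMoment ν) a a ≤ 2 * d := by
  rcases Nat.eq_zero_or_pos d with rfl | hd
  · obtain ⟨a, ha⟩ := A.nonempty
    refine ⟨Measure.dirac a, ⟨inferInstance, by simpa using ha, ?_⟩, fun b _ => ?_⟩
    · intro x _
      exact ⟨0, Subsingleton.elim _ _⟩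
    · simp [invForm, Subsingleton.elim b 0]
  set V := Submodule.span ℝ (A : Set (Vec d)) with hV
  let B : Set (Vec d) := {b | b ∈ Vᗮ ∧ ‖b‖ ≤ 1}
  have hB : B.Nonempty := ⟨0, Submodule.zero_mem _, by simp⟩
  have hspan : Submodule.span ℝ ((A : Set (Vec d)) ∪ B) = ⊤ := by
    rw [Submodule.span_union, ← hV, eq_top_iff,
      ← Submodule.sup_orthogonal_of_hasOrthogonalProjection (K := V)]
    refine sup_le_sup_left (fun x hx => ?_) V
    by_cases hx0 : x = 0
    · rw [hx0]; exact zero_mem _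
    · have h : x = ‖x‖ • (‖x‖⁻¹ • x) := by
        rw [smul_smul, mul_inv_cancel₀ (norm_ne_zero_iff.2 hx0), one_smul]
      rw [h]
      refine Submodule.smul_mem _ _ (Submodule.subset_span ⟨Vᗮ.smul_mem _ hx, ?_⟩)
      rw [norm_smul, norm_inv, norm_norm, inv_mul_cancel₀ (norm_ne_zero_iff.2 hx0)]
  obtain ⟨R, hR⟩ := A.isCompact.isBounded.exists_norm_le
  obtain ⟨M, hM, hdet, hle⟩ := exists_mem_convexHull_outer_dotProduct_inv_le hd
    (S := (A : Set (Vec d)) ∪ B) (R := max R 1) (by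
      rintro v (hv | hv)
      · exact (hR v hv).trans (le_max_left _ _)
      · exact hv.2.trans (le_max_right _ _)) hspan
  rw [Set.image_union, convexHull_union (A.nonempty.image _)
    (Set.Nonempty.image _ hB)] at hM
  obtain ⟨M₁, hM₁, W, hW, w, w', hw, hw', hww, rfl⟩ := mem_convexJoin.1 hM
  set M := w • M₁ + w' • W
  have hpre : ∀ a ∈ A, ∃ x : Vec d, Matrix.toEuclideanLin M₁ (w • x) = a ∧
      inner ℝ (w • x) a ≤ 2 * d := by
    intro a ha
    set x : Vec d := WithLp.toLp 2 (M⁻¹ *ᵥ a.ofLp) with hx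
    have haV : a ∈ V := Submodule.subset_span ha
    have hMx : Matrix.toEuclideanLin M x = a := by
      rw [Matrix.toLpLin_apply, hx]
      simp [Matrix.mulVec_mulVec, Matrix.mul_nonsing_inv _ hdet.ne'.isUnit]
    have h1 : Matrix.toEuclideanLin M₁ (w • x) ∈ V :=
      toEuclideanLin_mem_of_mem_convexHull_outer hM₁ Submodule.subset_span _
    have h2 : Matrix.toEuclideanLin W (w' • x) ∈ Vᗮ :=
      toEuclideanLin_mem_of_mem_convexHull_outer hW (fun b hb => hb.1) _
    have hsum : Matrix.toEuclideanLin M₁ (w • x) + Matrix.toEuclideanLin W (w' • x) = a := by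
      rw [← hMx]
      simp [M]
    -- Both `a` and the `M₁` part lie in `V`, so the part in `Vᗮ` vanishes and `w • x` is a preimage
    -- of `a` under `M₁` alone.
    have h3 : Matrix.toEuclideanLin W (w' • x) = 0 := by
      have h4 : Matrix.toEuclideanLin W (w' • x) ∈ V := by
        rw [← eq_sub_iff_add_eq'] at hsum
        rw [hsum]
        exact V.sub_mem haV h1
      exact Submodule.disjoint_def.1 V.orthogonal_disjoint _ h4 h2
    refine ⟨x, by simpa [h3] using hsum, ?_⟩
    have h5 : inner ℝ x a ≤ 2 * d := by
      have := hle a (Or.inl ha)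
      rw [EuclideanSpace.inner_eq_star_dotProduct]
      simpa [hx] using this
    rw [inner_smul_left]
    simp only [conj_trivial]
    have hd0 : (0 : ℝ) ≤ 2 * d := by positivity
    have hw1 : w ≤ 1 := by linarith
    nlinarith [mul_le_mul_of_nonneg_left h5 hw]
  obtain ⟨ν, hν, hνA, hνM⟩ := exists_measure_secondMoment_eq hM₁
  refine ⟨ν, ⟨hν, hνA, ?_⟩, fun a ha => ?_⟩
  · rw [hνM, Submodule.span_le]
    intro a ha
    obtain ⟨x, hx, -⟩ := hpre a ha
    exact ⟨_, hx⟩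
  · obtain ⟨x, hx, hxa⟩ := hpre a ha
    have := invForm_apply_of_mem_range (posSemidef_of_mem_convexHull_outer hM₁).1 (w • x)
      (v := a) ⟨_, hx⟩
    rw [hx] at this
    rw [hνM, this]
    exact hxa

theorem continuous_invForm_self (M : Matrix (Fin d) (Fin d) ℝ) :
    Continuous fun a : Vec d => invForm M a a := by
  unfold invForm
  exact continuous_id.inner (LinearMap.continuous_of_finiteDimensional _)

/-- Comparison with the design just constructed. Compactness of `A` is needed because a real `⨆`
over an unbounded family is `0` and would bound nothing. -/
theorem IsGOptimal.invForm_le {A : Ctx d} {ν : Measure (Vec d)} (h : IsGOptimal A ν) {a : Vec d}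
    (ha : a ∈ A) : invForm (secondMoment ν) a a ≤ 2 * d := by
  obtain ⟨ν', hν', hle⟩ := exists_isDesign_invForm_le A
  have hbdd : BddAbove (Set.range fun a : A => invForm (secondMoment ν) (a : Vec d) a) := by
    have := A.isCompact.bddAbove_image (continuous_invForm_self (secondMoment ν)).continuousOn
    rwa [Set.image_eq_range] at this
  have : Nonempty A := A.nonempty.to_subtype
  calc invForm (secondMoment ν) a a
      ≤ ⨆ a : A, invForm (secondMoment ν) (a : Vec d) a := le_ciSup hbdd ⟨a, ha⟩
    _ ≤ _ := h.2 ν' hν'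
    _ ≤ 2 * d := ciSup_le fun a => hle a a.2

end Design

/-! ### Second moment matrices of measures on an action set -/

section SecondMoment

variable {d : ℕ} {A : Ctx d} {ν : Measure (Vec d)}

theorem integrable_of_continuous_of_compl_eq_zero [IsFiniteMeasure ν]
    (hν : ν (A : Set (Vec d))ᶜ = 0) {f : Vec d → ℝ} (hf : Continuous f) : Integrable f ν := by
  have h := (hf.continuousOn (s := (A : Set (Vec d)))).integrableOn_compact (μ := ν) A.isCompact
  rwa [IntegrableOn,
    Measure.restrict_eq_self_of_ae_mem (s := (A : Set (Vec d))) (mem_ae_iff.2 hν)] at h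

theorem integrable_apply_mul_apply [IsFiniteMeasure ν] (hν : ν (A : Set (Vec d))ᶜ = 0)
    (i j : Fin d) : Integrable (fun a : Vec d => a i * a j) ν :=
  integrable_of_continuous_of_compl_eq_zero hν (by fun_prop)

theorem isHermitian_secondMoment (ν : Measure (Vec d)) : (secondMoment ν).IsHermitian := by
  ext i j
  simp [secondMoment, mul_comm]

theorem inner_toEuclideanLin_eq_sum (M : Matrix (Fin d) (Fin d) ℝ) (x z : Vec d) :
    inner ℝ x (Matrix.toEuclideanLin M z) = ∑ i, ∑ j, M i j * (x i * z j) := by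
  simp only [PiLp.inner_apply, Matrix.toLpLin_apply, Matrix.mulVec, dotProduct]
  refine Finset.sum_congr rfl fun i _ => ?_
  simp only [RCLike.inner_apply, conj_trivial, Finset.sum_mul]
  exact Finset.sum_congr rfl fun j _ => by ring

theorem inner_secondMoment [IsFiniteMeasure ν] (hν : ν (A : Set (Vec d))ᶜ = 0) (x z : Vec d) :
    inner ℝ x (Matrix.toEuclideanLin (secondMoment ν) z) =
      ∫ a, inner ℝ x a * inner ℝ a z ∂ν := by
  have h : ∀ a : Vec d, (inner ℝ x a * inner ℝ a z : ℝ) =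
      ∑ i, ∑ j, (a i * a j) * (x i * z j) := fun a => by
    simp only [PiLp.inner_apply, RCLike.inner_apply, conj_trivial, Finset.sum_mul_sum]
    exact Finset.sum_congr rfl fun i _ => Finset.sum_congr rfl fun j _ => by ring
  simp only [h]
  rw [inner_toEuclideanLin_eq_sum, integral_finsetSum _ fun i _ => integrable_finsetSum _
    fun j _ => (integrable_apply_mul_apply hν i j).mul_const _]
  refine Finset.sum_congr rfl fun i _ => ?_
  rw [integral_finsetSum _ fun j _ => (integrable_apply_mul_apply hν i j).mul_const _]
  exact Finset.sum_congr rfl fun j _ => by rw [integral_mul_const]; rfl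

theorem posSemidef_secondMoment [IsFiniteMeasure ν] (hν : ν (A : Set (Vec d))ᶜ = 0) :
    (secondMoment ν).PosSemidef := by
  refine Matrix.PosSemidef.of_dotProduct_mulVec_nonneg (isHermitian_secondMoment ν) fun x => ?_
  have h := inner_secondMoment hν (WithLp.toLp 2 x) (WithLp.toLp 2 x)
  have h2 : 0 ≤ inner ℝ (WithLp.toLp 2 x : Vec d)
      (Matrix.toEuclideanLin (secondMoment ν) (WithLp.toLp 2 x)) := by
    rw [h]
    refine integral_nonneg fun a => ?_
    rw [real_inner_comm]
    exact mul_self_nonneg _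
  rw [EuclideanSpace.inner_eq_star_dotProduct] at h2
  simpa [Matrix.toLpLin_apply, dotProduct_comm] using h2

theorem integral_inner_toEuclideanLin_self [IsFiniteMeasure ν] (hν : ν (A : Set (Vec d))ᶜ = 0)
    (N : Matrix (Fin d) (Fin d) ℝ) :
    ∫ a, inner ℝ a (Matrix.toEuclideanLin N a) ∂ν = (N * secondMoment ν).trace := by
  simp only [inner_toEuclideanLin_eq_sum]
  have hinteg : ∀ i j, Integrable (fun a : Vec d => N i j * (a i * a j)) ν :=
    fun i j => (integrable_apply_mul_apply hν i j).const_mul _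
  rw [integral_finsetSum Finset.univ (f := fun i (a : Vec d) => ∑ j, N i j * (a i * a j))
    fun i _ => integrable_finsetSum _ fun j _ => hinteg i j]
  refine Finset.sum_congr rfl fun i _ => ?_
  rw [integral_finsetSum Finset.univ (f := fun j (a : Vec d) => N i j * (a i * a j))
    fun j _ => hinteg i j, Matrix.diag_apply, Matrix.mul_apply]
  refine Finset.sum_congr rfl fun j _ => ?_
  rw [integral_const_mul]
  simp [secondMoment, mul_comm]

/-- With `M = E[a aᵀ]` the left side is `tr(M⁻¹ M)`, the trace of a projection. This is the source
of the dimension in the variance bound. -/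
theorem integral_invForm_self_le [IsFiniteMeasure ν] (hν : ν (A : Set (Vec d))ᶜ = 0) :
    ∫ a, invForm (secondMoment ν) a a ∂ν ≤ d := by
  simp only [invForm]
  rw [integral_inner_toEuclideanLin_self hν]
  exact trace_pinv_mul_self_le (isHermitian_secondMoment ν)

end SecondMoment

/-! ### Measurability of the pseudoinverse -/

section MeasurablePinv

variable {d : ℕ} {α : Type*} [MeasurableSpace α]

theorem measurable_comp_matrix {M : α → Matrix (Fin d) (Fin d) ℝ}
    (hM : ∀ i j, Measurable fun x => M x i j) {g : Matrix (Fin d) (Fin d) ℝ → ℝ}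
    (hg : Continuous g) : Measurable fun x => g (M x) := by
  have h1 : Continuous fun X : Fin d → Fin d → ℝ => g (Matrix.of X) :=
    hg.comp (continuous_matrix fun i j => by simp only [Matrix.of_apply]; fun_prop)
  exact h1.measurable.comp (measurable_pi_lambda _ fun i => measurable_pi_lambda _ fun j => hM i j)

theorem measurable_inv_matrix {M : α → Matrix (Fin d) (Fin d) ℝ}
    (hM : ∀ i j, Measurable fun x => M x i j) (i j : Fin d) :
    Measurable fun x => (M x)⁻¹ i j := by
  have h : ∀ x, (M x)⁻¹ i j = (M x).det⁻¹ * (M x).adjugate i j := fun x => by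
    rw [Matrix.inv_def, Ring.inverse_eq_inv', Matrix.smul_apply, smul_eq_mul]
  simp only [h]
  refine (measurable_comp_matrix hM (g := Matrix.det) ?_).inv.mul
    (measurable_comp_matrix hM (g := fun X => X.adjugate i j) ?_)
  · exact continuous_id.matrix_det
  · exact (continuous_id.matrix_adjugate).matrix_elem i j

/-- The pseudoinverse is discontinuous where the rank changes, so its measurability comes from this
limit of regularized inverses. On the finite spectrum `x / (x² + ε) → x⁻¹` pointwise, also at `x =
0`, where both sides are `0`. -/
theorem tendsto_pinv {M : Matrix (Fin d) (Fin d) ℝ} (hM : M.IsHermitian) :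
    Filter.Tendsto (fun n : ℕ => (M * M + (1 / ((n : ℝ) + 1)) • 1)⁻¹ * M) Filter.atTop
      (nhds (pinv M)) := by
  have hs : IsSelfAdjoint M := hM
  have hfin : (spectrum ℝ M).Finite := Matrix.finite_real_spectrum
  have hc : ∀ f : ℝ → ℝ, ContinuousOn f (spectrum ℝ M) := fun f => hfin.continuousOn f
  have hcfc : ∀ n : ℕ, (M * M + (1 / ((n : ℝ) + 1)) • 1)⁻¹ * M =
      cfc (fun x : ℝ => (x * x + 1 / ((n : ℝ) + 1))⁻¹ * x) M := fun n => by
    have hpos : (0 : ℝ) < 1 / ((n : ℝ) + 1) := by positivity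
    generalize 1 / ((n : ℝ) + 1) = ε at hpos
    have h1 : M * M + ε • 1 = cfc (fun x : ℝ => x * x + ε) M := by
      rw [cfc_add_const _ _ _ (hc _), cfc_mul _ _ _ (hc _) (hc _), cfc_id' ℝ M,
        Algebra.algebraMap_eq_smul_one]
    have h2 : cfc (fun x : ℝ => (x * x + ε)⁻¹) M * (M * M + ε • 1) = 1 := by
      rw [h1, ← cfc_mul _ _ _ (hc _) (hc _), ← cfc_const_one ℝ M]
      congr 1
      ext x
      have : x * x + ε ≠ 0 := by nlinarith [mul_self_nonneg x]
      exact inv_mul_cancel₀ this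
    rw [Matrix.inv_eq_left_inv h2, cfc_mul _ _ _ (hc _) (hc _), cfc_id' ℝ M]
  simp only [hcfc]
  refine tendsto_cfc_fun (Metric.tendstoUniformlyOn_iff.2 fun ε hε => ?_)
    (Filter.Eventually.of_forall fun n => hc _)
  refine (Filter.eventually_all_finite hfin).2 fun x _ => ?_
  have hlim : Filter.Tendsto (fun n : ℕ => (x * x + 1 / ((n : ℝ) + 1))⁻¹ * x) Filter.atTop
      (nhds x⁻¹) := by
    by_cases hx : x = 0
    · simp [hx]
    · have h1 : Filter.Tendsto (fun n : ℕ => x * x + 1 / ((n : ℝ) + 1)) Filter.atTop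
          (nhds (x * x + 0)) := tendsto_one_div_add_atTop_nhds_zero_nat.const_add _
      have h2 := (h1.inv₀ (by simpa using hx)).mul_const x
      have h3 : (x * x + 0)⁻¹ * x = x⁻¹ := by field_simp; ring
      rwa [h3] at h2
  have := Metric.tendsto_nhds.1 hlim ε hε
  filter_upwards [this] with n hn
  rwa [dist_comm]

theorem measurable_pinv {M : α → Matrix (Fin d) (Fin d) ℝ}
    (hM : ∀ i j, Measurable fun x => M x i j) (hH : ∀ x, (M x).IsHermitian) (i j : Fin d) :
    Measurable fun x => pinv (M x) i j := by
  refine measurable_of_tendsto_metrizable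
    (f := fun (n : ℕ) x => ((M x * M x + (1 / ((n : ℝ) + 1)) • 1)⁻¹ * M x) i j) (fun n => ?_) ?_
  · simp only [Matrix.mul_apply]
    refine Finset.measurable_sum _ fun k _ =>
      (measurable_inv_matrix (fun i j => ?_) i k).mul (hM k j)
    exact measurable_comp_matrix hM (g := fun X => (X * X + (1 / ((n : ℝ) + 1)) • 1) i j)
      (Continuous.matrix_elem (by fun_prop) i j)
  · refine tendsto_pi_nhds.2 fun x => ?_
    have h := tendsto_pinv (hH x)
    exact ((continuous_id.matrix_elem i j).tendsto _).comp h

theorem measurable_invForm {M : α → Matrix (Fin d) (Fin d) ℝ}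
    (hM : ∀ i j, Measurable fun x => M x i j) (hH : ∀ x, (M x).IsHermitian) {u v : α → Vec d}
    (hu : Measurable u) (hv : Measurable v) : Measurable fun x => invForm (M x) (u x) (v x) := by
  simp only [invForm, inner_toEuclideanLin_eq_sum]
  refine Finset.measurable_sum _ fun i _ => Finset.measurable_sum _ fun j _ =>
    (measurable_pinv hM hH i j).mul (Measurable.mul ?_ ?_) <;> fun_prop

end MeasurablePinv

/-! ### The action distribution for a fixed action set -/

namespace Exp4

variable {d : ℕ} {alg : Exp4 d}

/-- The properties of linear EXP4 that matter in a single round. -/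
structure IsAdmissible (alg : Exp4 d) : Prop where
  nonempty : alg.Θ.Nonempty
  greedy : IsGreedy alg.greedy
  explore : ∀ A, IsGOptimal A (alg.explore A)
  γ_pos : 0 < alg.γ
  γ_le : alg.γ ≤ 1

theorem weight_nonneg (L : Vec d → ℝ) (θ : Vec d) : 0 ≤ alg.weight L θ :=
  div_nonneg (Real.exp_pos _).le (Finset.sum_nonneg fun _ _ => (Real.exp_pos _).le)

namespace IsAdmissible

variable (h : alg.IsAdmissible) (L : Vec d → ℝ) (A : Ctx d)

include h

theorem sum_exp_pos : 0 < ∑ θ ∈ alg.Θ, Real.exp (-alg.η * L θ) :=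
  Finset.sum_pos (fun _ _ => Real.exp_pos _) h.nonempty

theorem sum_weight : ∑ θ ∈ alg.Θ, alg.weight L θ = 1 := by
  simp only [weight]
  rw [← Finset.sum_div, div_self (h.sum_exp_pos L).ne']

theorem weight_le_one {θ : Vec d} (hθ : θ ∈ alg.Θ) : alg.weight L θ ≤ 1 := by
  rw [← h.sum_weight L]
  exact Finset.single_le_sum (fun θ _ => weight_nonneg L θ) hθ

theorem isProbabilityMeasure_law : IsProbabilityMeasure (alg.law L A) := by
  have := (h.explore A).1.prob
  have hγ := h.γ_le
  refine ⟨?_⟩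
  simp only [law, Measure.coe_add, Measure.coe_smul, Pi.add_apply, Pi.smul_apply,
    Measure.coe_finsetSum, Finset.sum_apply, measure_univ, smul_eq_mul, mul_one]
  rw [← ENNReal.ofReal_sum_of_nonneg fun θ _ => weight_nonneg L θ, h.sum_weight,
    ENNReal.ofReal_one, mul_one, ← ENNReal.ofReal_add (by linarith) h.γ_pos.le]
  simp

theorem law_compl : alg.law L A (A : Set (Vec d))ᶜ = 0 := by
  have h0 := (h.explore A).1.supported
  have h1 : ∀ θ, Measure.dirac (alg.greedy θ A) (A : Set (Vec d))ᶜ = 0 := fun θ => by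
    rw [Measure.dirac_apply' _ A.isCompact.isClosed.measurableSet.compl]
    simpa using h.greedy.mem θ A
  simp [law, h0, h1]

theorem ae_law_mem : ∀ᵐ a ∂alg.law L A, a ∈ A := mem_ae_iff.2 (h.law_compl L A)

theorem integral_law {f : Vec d → ℝ} (hf : Continuous f) :
    ∫ a, f a ∂alg.law L A =
      (1 - alg.γ) * ∑ θ ∈ alg.Θ, alg.weight L θ * f (alg.greedy θ A) +
        alg.γ * ∫ a, f a ∂alg.explore A := by
  have := (h.explore A).1.prob
  have hγ := h.γ_le
  have hd : ∀ θ, Integrable f (ENNReal.ofReal (alg.weight L θ) • Measure.dirac (alg.greedy θ A)) :=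
    fun θ => (integrable_dirac (by simp)).smul_measure (by simp)
  have he : Integrable f (alg.explore A) :=
    integrable_of_continuous_of_compl_eq_zero (h.explore A).1.supported hf
  rw [law, integral_add_measure
      ((integrable_finsetSum_measure.2 fun θ _ => hd θ).smul_measure (by simp))
      (he.smul_measure (by simp)),
    integral_smul_measure, integral_smul_measure, integral_finsetSum_measure fun θ _ => hd θ,
    ENNReal.toReal_ofReal (by linarith), ENNReal.toReal_ofReal h.γ_pos.le, smul_eq_mul, smul_eq_mul]
  congr 2
  refine Finset.sum_congr rfl fun θ _ => ?_
  rw [integral_smul_measure, integral_dirac, ENNReal.toReal_ofReal (weight_nonneg L θ), smul_eq_mul]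

theorem integral_law_le {f : Vec d → ℝ} (hf : Continuous f) {K : ℝ} (hK : ∀ a ∈ A, f a ≤ K) :
    ∫ a, f a ∂alg.law L A ≤
      (1 - alg.γ) * ∑ θ ∈ alg.Θ, alg.weight L θ * f (alg.greedy θ A) + alg.γ * K := by
  have := (h.explore A).1.prob
  rw [h.integral_law L A hf]
  refine add_le_add_right (mul_le_mul_of_nonneg_left ?_ h.γ_pos.le) _
  have hae : ∀ᵐ a ∂alg.explore A, f a ≤ K :=
    Filter.mem_of_superset (mem_ae_iff.2 (h.explore A).1.supported) hK
  calc ∫ a, f a ∂alg.explore A ≤ ∫ _, K ∂alg.explore A :=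
        integral_mono_ae
          (integrable_of_continuous_of_compl_eq_zero (h.explore A).1.supported hf)
          (integrable_const _) hae
    _ = K := by simp

theorem sum_weight_mul_le_integral_law {f : Vec d → ℝ} (hf : Continuous f) (h0 : ∀ a, 0 ≤ f a) :
    (1 - alg.γ) * ∑ θ ∈ alg.Θ, alg.weight L θ * f (alg.greedy θ A) ≤
      ∫ a, f a ∂alg.law L A := by
  rw [h.integral_law L A hf]
  exact le_add_of_nonneg_right (mul_nonneg h.γ_pos.le (integral_nonneg h0))

theorem explore_mul_le_integral_law {f : Vec d → ℝ} (hf : Continuous f) (h0 : ∀ a, 0 ≤ f a) :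
    alg.γ * ∫ a, f a ∂alg.explore A ≤ ∫ a, f a ∂alg.law L A := by
  rw [h.integral_law L A hf]
  have := h.γ_le
  exact le_add_of_nonneg_left (mul_nonneg (by linarith)
    (Finset.sum_nonneg fun θ _ => mul_nonneg (weight_nonneg L θ) (h0 _)))

theorem posSemidef_law : (secondMoment (alg.law L A)).PosSemidef := by
  have := h.isProbabilityMeasure_law L A
  exact posSemidef_secondMoment (h.law_compl L A)

theorem posSemidef_explore : (secondMoment (alg.explore A)).PosSemidef := by
  have := (h.explore A).1.prob
  exact posSemidef_secondMoment (h.explore A).1.supported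

theorem secondMoment_explore_le (x : Vec d) :
    alg.γ * inner ℝ x (Matrix.toEuclideanLin (secondMoment (alg.explore A)) x) ≤
      inner ℝ x (Matrix.toEuclideanLin (secondMoment (alg.law L A)) x) := by
  have := (h.explore A).1.prob
  have := h.isProbabilityMeasure_law L A
  rw [inner_secondMoment (h.explore A).1.supported, inner_secondMoment (h.law_compl L A)]
  refine h.explore_mul_le_integral_law L A (by fun_prop) fun a => ?_
  rw [real_inner_comm]
  exact mul_self_nonneg _

theorem mem_range_explore {a : Vec d} (ha : a ∈ A) :
    a ∈ LinearMap.range (Matrix.toEuclideanLin (secondMoment (alg.explore A))) :=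
  (h.explore A).1.span_le (Submodule.subset_span ha)

theorem mem_range_law {a : Vec d} (ha : a ∈ A) :
    a ∈ LinearMap.range (Matrix.toEuclideanLin (secondMoment (alg.law L A))) :=
  range_toEuclideanLin_le_of_le (h.posSemidef_law L A) (h.posSemidef_explore A) h.γ_pos
    (h.secondMoment_explore_le L A) (h.mem_range_explore A ha)

/-- The exploration part alone gives `H ≥ γ G(ν)`, and inverse forms reverse this order on the
range, which contains `A`. -/
theorem invForm_law_self_le {a : Vec d} (ha : a ∈ A) :
    invForm (secondMoment (alg.law L A)) a a ≤ 2 * d / alg.γ :=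
  (invForm_self_le_of_le (h.posSemidef_law L A) (h.posSemidef_explore A) h.γ_pos
    (h.secondMoment_explore_le L A) (h.mem_range_explore A ha) (h.mem_range_law L A ha)).trans
    (div_le_div_of_nonneg_right ((h.explore A).invForm_le ha) h.γ_pos.le)

theorem abs_invForm_law_le {a b : Vec d} (ha : a ∈ A) (hb : b ∈ A) :
    |invForm (secondMoment (alg.law L A)) a b| ≤ 2 * d / alg.γ :=
  abs_invForm_le (h.posSemidef_law L A) (h.invForm_law_self_le L A ha)
    (h.invForm_law_self_le L A hb)

/-- The integral is `⟨H⁻¹ b, H y⟩`, which equals `⟨b, y⟩` because `b` lies in the range of `H`; `y`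
may be arbitrary. -/
theorem integral_invForm_mul_inner {b : Vec d} (hb : b ∈ A) (y : Vec d) :
    ∫ a, invForm (secondMoment (alg.law L A)) b a * inner ℝ a y ∂alg.law L A = inner ℝ b y := by
  have := h.isProbabilityMeasure_law L A
  simp only [invForm_eq_inner_left]
  rw [← inner_secondMoment (h.law_compl L A), ← invForm_eq_inner_left, invForm_comm,
    invForm_apply_of_mem_range (isHermitian_secondMoment _) _ (h.mem_range_law L A hb),
    real_inner_comm]

theorem integral_invForm_sq (b : Vec d) :
    ∫ a, invForm (secondMoment (alg.law L A)) b a ^ 2 ∂alg.law L A =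
      invForm (secondMoment (alg.law L A)) b b := by
  have := h.isProbabilityMeasure_law L A
  rw [invForm_self_eq (isHermitian_secondMoment _), inner_secondMoment (h.law_compl L A)]
  refine integral_congr_ae (Filter.Eventually.of_forall fun a => ?_)
  simp only [invForm_eq_inner_left]
  rw [sq, real_inner_comm a]

/-- The greedy actions carry the share `1 - γ` of the law, so their contribution to `E[aᵀ H⁻¹ a] ≤
d` is at most the whole. Keeping the factor `1 - γ` avoids a division that would fail as `γ`
approaches `1`. -/
theorem sum_weight_mul_invForm_le :
    (1 - alg.γ) * ∑ θ ∈ alg.Θ, alg.weight L θ *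
      invForm (secondMoment (alg.law L A)) (alg.greedy θ A) (alg.greedy θ A) ≤ d := by
  have := h.isProbabilityMeasure_law L A
  exact (h.sum_weight_mul_le_integral_law L A (continuous_invForm_self _)
    (invForm_self_nonneg (h.posSemidef_law L A))).trans
    (integral_invForm_self_le (h.law_compl L A))

end IsAdmissible

section Measurability

variable {α : Type*} [MeasurableSpace α] {L : α → Vec d → ℝ} {A : α → Ctx d}

theorem measurable_weight (hL : ∀ θ, Measurable fun x => L x θ) (θ : Vec d) :
    Measurable fun x => alg.weight (L x) θ :=
  ((hL θ).const_mul _).exp.div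
    (Finset.measurable_sum _ fun θ' _ => ((hL θ').const_mul _).exp)

theorem measurable_law (hg : IsGreedy alg.greedy) (hL : ∀ θ, Measurable fun x => L x θ)
    (hA : Measurable A) : Measurable fun x => alg.law (L x) (A x) := by
  refine Measure.measurable_of_measurable_coe _ fun S hS => ?_
  simp only [law, Measure.coe_add, Measure.coe_smul, Pi.add_apply, Pi.smul_apply,
    Measure.coe_finsetSum, Finset.sum_apply, smul_eq_mul]
  refine Measurable.add (Measurable.const_mul (Finset.measurable_sum _ fun θ _ => ?_) _)
    (Measurable.const_mul ?_ _)
  · refine (measurable_weight hL θ).ennreal_ofReal.mul ?_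
    exact (Measure.measurable_coe hS).comp
      (Measure.measurable_dirac.comp ((hg.measurable θ).comp hA))
  · exact (Kernel.measurable_coe alg.explore hS).comp hA

/-- The distribution of the action as a kernel from the observations. -/
def lawKernel (alg : Exp4 d) (hg : IsGreedy alg.greedy) (hL : ∀ θ, Measurable fun x => L x θ)
    (hA : Measurable A) : Kernel α (Vec d) :=
  ⟨fun x => alg.law (L x) (A x), measurable_law hg hL hA⟩

theorem measurable_secondMoment_law (hg : IsGreedy alg.greedy)
    (hL : ∀ θ, Measurable fun x => L x θ) (hA : Measurable A) (i j : Fin d) :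
    Measurable fun x => secondMoment (alg.law (L x) (A x)) i j := by
  have hf : StronglyMeasurable fun a : Vec d => a i * a j :=
    Continuous.stronglyMeasurable (by fun_prop)
  exact (hf.integral_kernel (κ := alg.lawKernel hg hL hA)).measurable

theorem measurable_invForm_law (hg : IsGreedy alg.greedy)
    (hL : ∀ θ, Measurable fun x => L x θ) (hA : Measurable A) {a : α → Vec d} (ha : Measurable a)
    (θ : Vec d) :
    Measurable fun x => invForm (secondMoment (alg.law (L x) (A x))) (alg.greedy θ (A x)) (a x) :=
  measurable_invForm (measurable_secondMoment_law hg hL hA)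
    (fun _ => isHermitian_secondMoment _) ((hg.measurable θ).comp hA) ha

theorem lossEst_eq (L : Vec d → ℝ) (A : Ctx d) (a : Vec d) (ℓ : ℝ) (θ : Vec d) :
    alg.lossEst L A a ℓ θ =
      invForm (secondMoment (alg.law L A)) (alg.greedy θ A) a * ℓ := by
  simp [lossEst, invForm, inner_smul_right, mul_comm]

theorem measurable_lossEst (hg : IsGreedy alg.greedy)
    (hL : ∀ θ, Measurable fun x => L x θ) (hA : Measurable A) {a : α → Vec d} (ha : Measurable a)
    {ℓ : α → ℝ} (hℓ : Measurable ℓ) (θ : Vec d) :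
    Measurable fun x => alg.lossEst (L x) (A x) (a x) (ℓ x) θ := by
  simp only [lossEst_eq]
  exact (measurable_invForm_law hg hL hA ha θ).mul hℓ

theorem measurable_cumLoss (hg : IsGreedy alg.greedy) {A : ℕ → α → Ctx d} {a : ℕ → α → Vec d}
    {ℓ : ℕ → α → ℝ} {t : ℕ} (hA : ∀ s < t, Measurable (A s)) (ha : ∀ s < t, Measurable (a s))
    (hℓ : ∀ s < t, Measurable (ℓ s)) (θ : Vec d) :
    Measurable fun x => alg.cumLoss (fun s => A s x) (fun s => a s x) (fun s => ℓ s x) t θ := by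
  induction t generalizing θ with
  | zero => exact measurable_const
  | succ t ih =>
    have ih' := ih (fun s hs => hA s (hs.trans t.lt_succ_self))
      (fun s hs => ha s (hs.trans t.lt_succ_self)) fun s hs => hℓ s (hs.trans t.lt_succ_self)
    exact (ih' θ).add (measurable_lossEst hg ih' (hA t t.lt_succ_self) (ha t t.lt_succ_self)
      (hℓ t t.lt_succ_self) θ)

end Measurability

end Exp4

/-! ### Averaging over a variable with a prescribed conditional law -/

section Disintegration

variable {H E Ω : Type*} [MeasurableSpace H] [MeasurableSpace E] [MeasurableSpace Ω]
  {μ : Measure Ω} [IsProbabilityMeasure μ] {Y : Ω → H} {X : Ω → E} {κ : Kernel H E}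
  [IsMarkovKernel κ]

theorem map_prodMk_eq_compProd (hY : Measurable Y) (hX : Measurable X)
    (h : ∀ B, MeasurableSet B → ∀ S, MeasurableSet S →
      μ (Y ⁻¹' B ∩ X ⁻¹' S) = ∫⁻ ω in Y ⁻¹' B, κ (Y ω) S ∂μ) :
    μ.map (fun ω => (Y ω, X ω)) = μ.map Y ⊗ₘ κ := by
  have := Measure.isProbabilityMeasure_map (μ := μ) hY.aemeasurable
  have := Measure.isProbabilityMeasure_map (μ := μ) (hY.prodMk hX).aemeasurable
  refine Measure.ext_prod fun {B S} hB hS => ?_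
  rw [Measure.map_apply (hY.prodMk hX) (hB.prod hS), Measure.compProd_apply_prod hB hS,
    setLIntegral_map hB (κ.measurable_coe hS) hY, ← h B hB S hS]
  rfl

variable (hY : Measurable Y) (hX : Measurable X)
  (hmap : μ.map (fun ω => (Y ω, X ω)) = μ.map Y ⊗ₘ κ)

include hY hX hmap

theorem ae_of_ae_kernel {p : H × E → Prop} (hp : MeasurableSet {x | p x})
    (h : ∀ᵐ ω ∂μ, ∀ᵐ a ∂κ (Y ω), p (Y ω, a)) : ∀ᵐ ω ∂μ, p (Y ω, X ω) := by
  have := Measure.isProbabilityMeasure_map (μ := μ) hY.aemeasurable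
  refine (ae_map_iff (hY.prodMk hX).aemeasurable hp).1 ?_
  rw [hmap, Measure.ae_compProd_iff hp]
  refine (ae_map_iff hY.aemeasurable ?_).2 h
  exact Kernel.measurable_kernel_prodMk_left (κ := κ) hp.compl (measurableSet_singleton 0)

theorem integral_eq_integral_kernel {F : H × E → ℝ} (hF : Measurable F) {K : ℝ}
    (hK : ∀ᵐ ω ∂μ, |F (Y ω, X ω)| ≤ K) :
    ∫ ω, F (Y ω, X ω) ∂μ = ∫ ω, ∫ a, F (Y ω, a) ∂κ (Y ω) ∂μ := by
  have := Measure.isProbabilityMeasure_map (μ := μ) hY.aemeasurable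
  have hinteg : Integrable F (μ.map fun ω => (Y ω, X ω)) :=
    (integrable_map_measure hF.aestronglyMeasurable (hY.prodMk hX).aemeasurable).2
      (Integrable.of_bound (hF.comp (hY.prodMk hX)).aestronglyMeasurable K hK)
  rw [← integral_map (hY.prodMk hX).aemeasurable hF.aestronglyMeasurable, hmap,
    Measure.integral_compProd (hmap ▸ hinteg), integral_map hY.aemeasurable]
  exact hF.stronglyMeasurable.integral_kernel_prod_right'.aestronglyMeasurable

end Disintegration

/-! ### Bias, range and variance of the estimates in one round -/

section Round

variable {d : ℕ} {H Ω : Type*} [MeasurableSpace Ω]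

/-- One round of linear EXP4: the history, the loss vector and the action set are functions of a
random variable `Y`, the action is `X` and the observed loss is `ℓ`. -/
structure IsRound [MeasurableSpace H] (alg : Exp4 d) (μ : Measure Ω) (Y : Ω → H)
    (L : H → Vec d → ℝ) (A : H → Ctx d) (y : H → Vec d) (X : Ω → Vec d) (ℓ : Ω → ℝ) : Prop where
  measurable_Y : Measurable Y
  measurable_L : ∀ θ, Measurable fun x => L x θ
  measurable_A : Measurable A
  measurable_y : Measurable y
  measurable_X : Measurable X
  measurable_ℓ : Measurable ℓ
  subset_ball : ∀ᵐ ω ∂μ, (A (Y ω) : Set (Vec d)) ⊆ Metric.closedBall 0 1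
  norm_y_le : ∀ᵐ ω ∂μ, ‖y (Y ω)‖ ≤ 1
  abs_ℓ_le : ∀ᵐ ω ∂μ, |ℓ ω| ≤ 1
  law_X : ∀ B, MeasurableSet B → ∀ S, MeasurableSet S →
    μ (Y ⁻¹' B ∩ X ⁻¹' S) = ∫⁻ ω in Y ⁻¹' B, alg.law (L (Y ω)) (A (Y ω)) S ∂μ
  mean_ℓ : ∀ g : H × Vec d → ℝ, Measurable g → ∀ K : ℝ, (∀ᵐ ω ∂μ, |g (Y ω, X ω)| ≤ K) →
    ∫ ω, g (Y ω, X ω) * ℓ ω ∂μ = ∫ ω, g (Y ω, X ω) * inner ℝ (X ω) (y (Y ω)) ∂μ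

namespace IsRound

variable {mH : MeasurableSpace H} {alg : Exp4 d} {μ : Measure Ω} [IsProbabilityMeasure μ]
  {Y : Ω → H} {L : H → Vec d → ℝ} {A : H → Ctx d} {y : H → Vec d} {X : Ω → Vec d} {ℓ : Ω → ℝ}
  (h : alg.IsAdmissible) (hr : IsRound alg μ Y L A y X ℓ)

include h hr

theorem ae_of_ae_law {p : H × Vec d → Prop} (hp : MeasurableSet {x | p x})
    (hae : ∀ᵐ ω ∂μ, ∀ᵐ a ∂alg.law (L (Y ω)) (A (Y ω)), p (Y ω, a)) :
    ∀ᵐ ω ∂μ, p (Y ω, X ω) := by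
  let κ := alg.lawKernel h.greedy hr.measurable_L hr.measurable_A
  have : IsMarkovKernel κ := ⟨fun x => h.isProbabilityMeasure_law (L x) (A x)⟩
  exact ae_of_ae_kernel hr.measurable_Y hr.measurable_X
    (map_prodMk_eq_compProd (κ := κ) hr.measurable_Y hr.measurable_X hr.law_X) hp hae

theorem integral_eq_integral_law {F : H × Vec d → ℝ} (hF : Measurable F) {K : ℝ}
    (hK : ∀ᵐ ω ∂μ, |F (Y ω, X ω)| ≤ K) :
    ∫ ω, F (Y ω, X ω) ∂μ = ∫ ω, ∫ a, F (Y ω, a) ∂alg.law (L (Y ω)) (A (Y ω)) ∂μ := by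
  let κ := alg.lawKernel h.greedy hr.measurable_L hr.measurable_A
  have : IsMarkovKernel κ := ⟨fun x => h.isProbabilityMeasure_law (L x) (A x)⟩
  exact integral_eq_integral_kernel hr.measurable_Y hr.measurable_X
    (map_prodMk_eq_compProd (κ := κ) hr.measurable_Y hr.measurable_X hr.law_X) hF hK

theorem norm_X_le : ∀ᵐ ω ∂μ, ‖X ω‖ ≤ 1 := by
  refine ae_of_ae_law h hr (p := fun x => ‖x.2‖ ≤ 1)
    (measurableSet_le (by fun_prop) measurable_const) ?_
  filter_upwards [hr.subset_ball] with ω hω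
  filter_upwards [h.ae_law_mem (L (Y ω)) (A (Y ω))] with a ha
  simpa using hω ha

omit [IsProbabilityMeasure μ] in
theorem norm_greedy_le (θ : Vec d) : ∀ᵐ ω ∂μ, ‖alg.greedy θ (A (Y ω))‖ ≤ 1 := by
  filter_upwards [hr.subset_ball] with ω hω
  simpa using hω (h.greedy.mem θ (A (Y ω)))

theorem abs_inner_X_le : ∀ᵐ ω ∂μ, |inner ℝ (X ω) (y (Y ω))| ≤ 1 := by
  filter_upwards [norm_X_le h hr, hr.norm_y_le] with ω h1 h2
  exact (abs_real_inner_le_norm _ _).trans (mul_le_one₀ h1 (norm_nonneg _) h2)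

omit [IsProbabilityMeasure μ] in
theorem abs_inner_greedy_le (θ : Vec d) :
    ∀ᵐ ω ∂μ, |inner ℝ (alg.greedy θ (A (Y ω))) (y (Y ω))| ≤ 1 := by
  filter_upwards [norm_greedy_le h hr θ, hr.norm_y_le] with ω h1 h2
  exact (abs_real_inner_le_norm _ _).trans (mul_le_one₀ h1 (norm_nonneg _) h2)

omit [IsProbabilityMeasure μ] in
theorem measurable_invForm_prod (θ : Vec d) :
    Measurable fun x : H × Vec d => invForm (secondMoment (alg.law (L x.1) (A x.1)))
      (alg.greedy θ (A x.1)) x.2 :=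
  Exp4.measurable_invForm_law (L := fun x : H × Vec d => L x.1) h.greedy
    (fun θ => (hr.measurable_L θ).comp measurable_fst) (hr.measurable_A.comp measurable_fst)
    measurable_snd θ

theorem abs_invForm_le (θ : Vec d) :
    ∀ᵐ ω ∂μ, |invForm (secondMoment (alg.law (L (Y ω)) (A (Y ω))))
      (alg.greedy θ (A (Y ω))) (X ω)| ≤ 2 * d / alg.γ := by
  refine ae_of_ae_law h hr (p := fun x => |invForm (secondMoment (alg.law (L x.1) (A x.1)))
      (alg.greedy θ (A x.1)) x.2| ≤ 2 * d / alg.γ)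
    (measurableSet_le (measurable_invForm_prod h hr θ).abs measurable_const) ?_
  refine Filter.Eventually.of_forall fun ω => ?_
  filter_upwards [h.ae_law_mem (L (Y ω)) (A (Y ω))] with a ha
  exact h.abs_invForm_law_le _ _ (h.greedy.mem _ _) ha

theorem abs_lossEst_le (θ : Vec d) :
    ∀ᵐ ω ∂μ, |alg.lossEst (L (Y ω)) (A (Y ω)) (X ω) (ℓ ω) θ| ≤ 2 * d / alg.γ := by
  filter_upwards [abs_invForm_le h hr θ, hr.abs_ℓ_le] with ω h1 h2
  rw [Exp4.lossEst_eq, abs_mul]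
  exact (mul_le_of_le_one_right (abs_nonneg _) h2).trans h1

omit [IsProbabilityMeasure μ] in
theorem measurable_lossEst (θ : Vec d) :
    Measurable fun ω => alg.lossEst (L (Y ω)) (A (Y ω)) (X ω) (ℓ ω) θ :=
  Exp4.measurable_lossEst (L := fun ω => L (Y ω)) h.greedy
    (fun θ => (hr.measurable_L θ).comp hr.measurable_Y)
    (hr.measurable_A.comp hr.measurable_Y) hr.measurable_X hr.measurable_ℓ θ

/-- The loss estimates are unbiased given the history. -/
theorem integral_mul_lossEst {p : H → ℝ} (hp : Measurable p) (hp1 : ∀ x, |p x| ≤ 1) (θ : Vec d) :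
    ∫ ω, p (Y ω) * alg.lossEst (L (Y ω)) (A (Y ω)) (X ω) (ℓ ω) θ ∂μ =
      ∫ ω, p (Y ω) * inner ℝ (alg.greedy θ (A (Y ω))) (y (Y ω)) ∂μ := by
  set q : H × Vec d → ℝ := fun x => p x.1 * invForm (secondMoment (alg.law (L x.1) (A x.1)))
      (alg.greedy θ (A x.1)) x.2 with hq
  have hqm : Measurable q := (hp.comp measurable_fst).mul (measurable_invForm_prod h hr θ)
  have hqK : ∀ᵐ ω ∂μ, |q (Y ω, X ω)| ≤ 2 * d / alg.γ := by
    filter_upwards [abs_invForm_le h hr θ] with ω h1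
    rw [hq, abs_mul]
    exact (mul_le_of_le_one_left (abs_nonneg _) (hp1 _)).trans h1
  have h1 : ∫ ω, p (Y ω) * alg.lossEst (L (Y ω)) (A (Y ω)) (X ω) (ℓ ω) θ ∂μ =
      ∫ ω, q (Y ω, X ω) * ℓ ω ∂μ := by
    simp only [Exp4.lossEst_eq, hq, mul_assoc]
  -- The two sources of randomness are averaged one at a time: first `ℓ` given the action, then the
  -- action given the history.
  rw [h1, hr.mean_ℓ q hqm _ hqK]
  have hF : Measurable fun x : H × Vec d => q x * inner ℝ x.2 (y x.1) :=
    hqm.mul (measurable_snd.inner (hr.measurable_y.comp measurable_fst))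
  rw [integral_eq_integral_law h hr (F := fun x => q x * inner ℝ x.2 (y x.1)) hF
    (K := 2 * d / alg.γ)]
  · refine integral_congr_ae (Filter.Eventually.of_forall fun ω => ?_)
    simp only [hq, mul_assoc]
    rw [integral_const_mul, h.integral_invForm_mul_inner _ _ (h.greedy.mem _ _)]
  · filter_upwards [hqK, abs_inner_X_le h hr] with ω h1 h2
    rw [abs_mul]
    exact (mul_le_of_le_one_right (abs_nonneg _) h2).trans h1

theorem integrable_weight_mul_lossEst_sq {θ : Vec d} (hθ : θ ∈ alg.Θ) :
    Integrable (fun ω => alg.weight (L (Y ω)) θ *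
      alg.lossEst (L (Y ω)) (A (Y ω)) (X ω) (ℓ ω) θ ^ 2) μ := by
  refine Integrable.of_bound (C := (2 * d / alg.γ) ^ 2) (Measurable.aestronglyMeasurable
    (((Exp4.measurable_weight hr.measurable_L θ).comp hr.measurable_Y).mul
      ((measurable_lossEst h hr θ).pow_const 2))) ?_
  filter_upwards [abs_lossEst_le h hr θ] with ω h1
  rw [Real.norm_eq_abs, abs_mul, abs_pow, abs_of_nonneg (Exp4.weight_nonneg _ _)]
  exact (mul_le_of_le_one_left (by positivity) (h.weight_le_one _ hθ)).trans
    (pow_le_pow_left₀ (abs_nonneg _) h1 2)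

/-- Since `ℓ² ≤ 1`, the squared estimate is at most `⟨b, H⁻¹ X⟩²`, where `b` is the greedy action.
Averaging over `X` turns this into `⟨b, H⁻¹ b⟩`, and the trace bound applies. -/
theorem integral_weight_mul_lossEst_sq_le :
    (1 - alg.γ) * ∫ ω, ∑ θ ∈ alg.Θ, alg.weight (L (Y ω)) θ *
      alg.lossEst (L (Y ω)) (A (Y ω)) (X ω) (ℓ ω) θ ^ 2 ∂μ ≤ d := by
  have hγ : 0 ≤ 1 - alg.γ := by linarith [h.γ_le]
  set q : Vec d → H × Vec d → ℝ := fun θ x => alg.weight (L x.1) θ *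
    invForm (secondMoment (alg.law (L x.1) (A x.1))) (alg.greedy θ (A x.1)) x.2 ^ 2 with hq
  have hqm : ∀ θ, Measurable (q θ) := fun θ =>
    ((Exp4.measurable_weight hr.measurable_L θ).comp measurable_fst).mul
      ((measurable_invForm_prod h hr θ).pow_const 2)
  have hq0 : ∀ θ x, 0 ≤ q θ x := fun θ x => mul_nonneg (Exp4.weight_nonneg _ _) (sq_nonneg _)
  have hqK : ∀ θ ∈ alg.Θ, ∀ᵐ ω ∂μ, |q θ (Y ω, X ω)| ≤ (2 * d / alg.γ) ^ 2 := fun θ hθ => by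
    filter_upwards [abs_invForm_le h hr θ] with ω h1
    rw [abs_of_nonneg (hq0 _ _), hq]
    refine (mul_le_of_le_one_left (by positivity) (h.weight_le_one _ hθ)).trans ?_
    rw [← sq_abs]
    exact pow_le_pow_left₀ (abs_nonneg _) h1 2
  have hqi : ∀ θ ∈ alg.Θ, Integrable (fun ω => q θ (Y ω, X ω)) μ := fun θ hθ =>
    Integrable.of_bound
      ((hqm θ).comp (hr.measurable_Y.prodMk hr.measurable_X)).aestronglyMeasurable _ (hqK θ hθ)
  have h1 : ∫ ω, ∑ θ ∈ alg.Θ, alg.weight (L (Y ω)) θ *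
      alg.lossEst (L (Y ω)) (A (Y ω)) (X ω) (ℓ ω) θ ^ 2 ∂μ ≤
      ∫ ω, ∑ θ ∈ alg.Θ, q θ (Y ω, X ω) ∂μ := by
    refine integral_mono_ae (integrable_finsetSum _ fun θ hθ =>
      integrable_weight_mul_lossEst_sq h hr hθ) (integrable_finsetSum _ hqi) ?_
    filter_upwards [hr.abs_ℓ_le] with ω hω
    refine Finset.sum_le_sum fun θ _ => mul_le_mul_of_nonneg_left ?_ (Exp4.weight_nonneg _ _)
    rw [Exp4.lossEst_eq, mul_pow]
    exact mul_le_of_le_one_right (sq_nonneg _) ((sq_le_one_iff_abs_le_one _).2 hω)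
  have h2 : ∀ θ ∈ alg.Θ, ∫ ω, q θ (Y ω, X ω) ∂μ = ∫ ω, alg.weight (L (Y ω)) θ *
      invForm (secondMoment (alg.law (L (Y ω)) (A (Y ω)))) (alg.greedy θ (A (Y ω)))
        (alg.greedy θ (A (Y ω))) ∂μ := fun θ hθ => by
    rw [integral_eq_integral_law h hr (hqm θ) (hqK θ hθ)]
    refine integral_congr_ae (Filter.Eventually.of_forall fun ω => ?_)
    simp only [hq]
    rw [integral_const_mul, h.integral_invForm_sq]
  have hi : ∀ θ ∈ alg.Θ, Integrable (fun ω => alg.weight (L (Y ω)) θ *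
      invForm (secondMoment (alg.law (L (Y ω)) (A (Y ω)))) (alg.greedy θ (A (Y ω)))
        (alg.greedy θ (A (Y ω)))) μ := fun θ hθ => by
    refine Integrable.of_bound (C := 2 * d / alg.γ) (Measurable.aestronglyMeasurable
      (((Exp4.measurable_weight hr.measurable_L θ).comp hr.measurable_Y).mul
        (Exp4.measurable_invForm_law (L := fun ω => L (Y ω)) h.greedy
          (fun θ => (hr.measurable_L θ).comp hr.measurable_Y)
          (hr.measurable_A.comp hr.measurable_Y)
          ((h.greedy.measurable θ).comp (hr.measurable_A.comp hr.measurable_Y)) θ)))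
      (Filter.Eventually.of_forall fun ω => ?_)
    rw [Real.norm_eq_abs, abs_mul, abs_of_nonneg (Exp4.weight_nonneg _ _)]
    exact (mul_le_of_le_one_left (abs_nonneg _) (h.weight_le_one _ hθ)).trans
      (h.abs_invForm_law_le _ _ (h.greedy.mem _ _) (h.greedy.mem _ _))
  refine (mul_le_mul_of_nonneg_left h1 hγ).trans ?_
  rw [integral_finsetSum _ hqi, Finset.sum_congr rfl h2, ← integral_finsetSum _ hi,
    ← integral_const_mul]
  calc _ ≤ ∫ _, (d : ℝ) ∂μ := integral_mono ((integrable_finsetSum _ hi).const_mul _)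
        (integrable_const _) fun ω => h.sum_weight_mul_invForm_le (L (Y ω)) (A (Y ω))
    _ = d := by simp

theorem integrable_weight_mul_inner_greedy {θ : Vec d} (hθ : θ ∈ alg.Θ) :
    Integrable (fun ω => alg.weight (L (Y ω)) θ *
      inner ℝ (alg.greedy θ (A (Y ω))) (y (Y ω))) μ := by
  refine Integrable.of_bound (C := 1) (Measurable.aestronglyMeasurable
    (((Exp4.measurable_weight hr.measurable_L θ).comp hr.measurable_Y).mul
      (((h.greedy.measurable θ).comp (hr.measurable_A.comp hr.measurable_Y)).inner
        (hr.measurable_y.comp hr.measurable_Y)))) ?_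
  filter_upwards [abs_inner_greedy_le h hr θ] with ω h1
  rw [Real.norm_eq_abs, abs_mul, abs_of_nonneg (Exp4.weight_nonneg _ _)]
  exact mul_le_one₀ (h.weight_le_one _ hθ) (abs_nonneg _) h1

/-- An exploratory action costs at most `1` and is taken with probability `γ`. -/
theorem integral_inner_X_le :
    ∫ ω, inner ℝ (X ω) (y (Y ω)) ∂μ ≤
      (1 - alg.γ) * (∫ ω, ∑ θ ∈ alg.Θ, alg.weight (L (Y ω)) θ *
        inner ℝ (alg.greedy θ (A (Y ω))) (y (Y ω)) ∂μ) + alg.γ := by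
  have hF : Measurable fun x : H × Vec d => (inner ℝ x.2 (y x.1) : ℝ) :=
    measurable_snd.inner (hr.measurable_y.comp measurable_fst)
  have hi := integrable_finsetSum _ fun θ hθ => integrable_weight_mul_inner_greedy h hr hθ
  rw [integral_eq_integral_law h hr (F := fun x => inner ℝ x.2 (y x.1)) hF (abs_inner_X_le h hr),
    ← integral_const_mul]
  have h2 : ∫ ω, ((1 - alg.γ) * ∑ θ ∈ alg.Θ, alg.weight (L (Y ω)) θ *
        inner ℝ (alg.greedy θ (A (Y ω))) (y (Y ω)) + alg.γ) ∂μ =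
      (∫ ω, (1 - alg.γ) * ∑ θ ∈ alg.Θ, alg.weight (L (Y ω)) θ *
        inner ℝ (alg.greedy θ (A (Y ω))) (y (Y ω)) ∂μ) + alg.γ := by
    rw [integral_add (hi.const_mul _) (integrable_const _)]
    simp
  rw [← h2]
  have hae : ∀ᵐ ω ∂μ, ∀ a ∈ A (Y ω), |inner ℝ a (y (Y ω))| ≤ 1 := by
    filter_upwards [hr.subset_ball, hr.norm_y_le] with ω h3 h4 a ha
    have : ‖a‖ ≤ 1 := by simpa using h3 ha
    exact (abs_real_inner_le_norm _ _).trans (mul_le_one₀ this (norm_nonneg _) h4)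
  have hmeas : AEStronglyMeasurable (fun ω => ∫ a, inner ℝ a (y (Y ω))
      ∂alg.law (L (Y ω)) (A (Y ω))) μ := by
    let κ := alg.lawKernel h.greedy hr.measurable_L hr.measurable_A
    have : IsMarkovKernel κ := ⟨fun x => h.isProbabilityMeasure_law (L x) (A x)⟩
    have hk := hF.stronglyMeasurable.integral_kernel_prod_right' (κ := κ)
    exact (hk.comp_measurable hr.measurable_Y).aestronglyMeasurable
  refine integral_mono_ae ?_ ((hi.const_mul _).add (integrable_const _)) ?_
  · refine Integrable.of_bound (C := 1) hmeas ?_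
    filter_upwards [hae] with ω hω
    have := h.isProbabilityMeasure_law (L (Y ω)) (A (Y ω))
    have hb := norm_integral_le_of_norm_le_const (μ := alg.law (L (Y ω)) (A (Y ω)))
      (f := fun a => inner ℝ a (y (Y ω))) (C := 1)
      (by filter_upwards [h.ae_law_mem (L (Y ω)) (A (Y ω))] with a ha using hω a ha)
    simpa using hb
  · filter_upwards [hae] with ω hω
    have := h.integral_law_le (L (Y ω)) (A (Y ω)) (f := fun a => inner ℝ a (y (Y ω)))
      (by fun_prop) (K := 1) fun a ha => (abs_le.1 (hω a ha)).2
    simpa using this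

theorem integrable_weight_mul_lossEst {θ : Vec d} (hθ : θ ∈ alg.Θ) :
    Integrable (fun ω => alg.weight (L (Y ω)) θ *
      alg.lossEst (L (Y ω)) (A (Y ω)) (X ω) (ℓ ω) θ) μ := by
  refine Integrable.of_bound (C := 2 * d / alg.γ) (Measurable.aestronglyMeasurable
    (((Exp4.measurable_weight hr.measurable_L θ).comp hr.measurable_Y).mul
      (measurable_lossEst h hr θ))) ?_
  filter_upwards [abs_lossEst_le h hr θ] with ω h1
  rw [Real.norm_eq_abs, abs_mul, abs_of_nonneg (Exp4.weight_nonneg _ _)]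
  exact (mul_le_of_le_one_left (abs_nonneg _) (h.weight_le_one _ hθ)).trans h1

/-- The weights are functions of the history, so they can serve as multipliers in the unbiasedness
of the estimates. -/
theorem integral_inner_X_le_lossEst :
    ∫ ω, inner ℝ (X ω) (y (Y ω)) ∂μ ≤
      (1 - alg.γ) * (∫ ω, ∑ θ ∈ alg.Θ, alg.weight (L (Y ω)) θ *
        alg.lossEst (L (Y ω)) (A (Y ω)) (X ω) (ℓ ω) θ ∂μ) + alg.γ := by
  refine (integral_inner_X_le h hr).trans_eq ?_
  rw [integral_finsetSum _ fun θ hθ => integrable_weight_mul_inner_greedy h hr hθ,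
    integral_finsetSum _ fun θ hθ => integrable_weight_mul_lossEst h hr hθ]
  congr 2
  refine Finset.sum_congr rfl fun θ hθ => (integral_mul_lossEst h hr
    (p := fun x => alg.weight (L x) θ) (Exp4.measurable_weight hr.measurable_L θ)
    (fun x => ?_) θ).symm
  rw [abs_of_nonneg (Exp4.weight_nonneg _ _)]
  exact h.weight_le_one _ hθ

end IsRound

end Round

/-! ### Exponential weights for a deterministic sequence of losses -/

section ExponentialWeights

variable {d : ℕ} {alg : Exp4 d}

theorem exp_neg_le_one_sub_add_sq {x : ℝ} (hx : |x| ≤ 1) : Real.exp (-x) ≤ 1 - x + x ^ 2 := by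
  have h := Real.abs_exp_sub_one_sub_id_le (x := -x) (by rwa [abs_neg])
  have := (abs_le.1 h).2
  rw [neg_sq] at this
  linarith

/-- One step of the potential argument: `exp (-x) ≤ 1 - x + x²` for `|x| ≤ 1` termwise, then `1 + u
≤ exp u` for the average. -/
theorem Exp4.IsAdmissible.sum_exp_add_le (h : alg.IsAdmissible) (L e : Vec d → ℝ)
    (he : ∀ θ ∈ alg.Θ, |alg.η * e θ| ≤ 1) :
    ∑ θ ∈ alg.Θ, Real.exp (-alg.η * (L θ + e θ)) ≤
      (∑ θ ∈ alg.Θ, Real.exp (-alg.η * L θ)) *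
        Real.exp (-alg.η * ∑ θ ∈ alg.Θ, alg.weight L θ * e θ +
          alg.η ^ 2 * ∑ θ ∈ alg.Θ, alg.weight L θ * e θ ^ 2) := by
  set Z := ∑ θ ∈ alg.Θ, Real.exp (-alg.η * L θ) with hZ
  have hZpos : 0 < Z := h.sum_exp_pos L
  have hw : ∀ θ, Real.exp (-alg.η * L θ) = Z * alg.weight L θ := fun θ => by
    rw [Exp4.weight, mul_div_cancel₀ _ hZpos.ne']
  calc ∑ θ ∈ alg.Θ, Real.exp (-alg.η * (L θ + e θ))
      ≤ ∑ θ ∈ alg.Θ, Z * (alg.weight L θ * (1 - alg.η * e θ + (alg.η * e θ) ^ 2)) := by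
        refine Finset.sum_le_sum fun θ hθ => ?_
        rw [mul_add, Real.exp_add, hw, mul_assoc, neg_mul]
        exact mul_le_mul_of_nonneg_left (mul_le_mul_of_nonneg_left
          (exp_neg_le_one_sub_add_sq (he θ hθ)) (Exp4.weight_nonneg L θ)) hZpos.le
    _ = Z * (1 + (-alg.η * ∑ θ ∈ alg.Θ, alg.weight L θ * e θ +
          alg.η ^ 2 * ∑ θ ∈ alg.Θ, alg.weight L θ * e θ ^ 2)) := by
        rw [← Finset.mul_sum]
        nth_rw 2 [← h.sum_weight L]
        rw [Finset.mul_sum alg.Θ _ (-alg.η), Finset.mul_sum alg.Θ _ (alg.η ^ 2),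
          ← Finset.sum_add_distrib, ← Finset.sum_add_distrib]
        congr 1
        exact Finset.sum_congr rfl fun θ _ => by ring
    _ ≤ _ := by
        refine mul_le_mul_of_nonneg_left ?_ hZpos.le
        rw [add_comm]
        exact Real.add_one_le_exp _

/-- The regret bound of exponential weights for a given sequence of losses. -/
theorem Exp4.IsAdmissible.exponential_weights (h : alg.IsAdmissible) (hη : 0 < alg.η)
    (L e : ℕ → Vec d → ℝ) (hL0 : ∀ θ, L 0 θ = 0) (hL : ∀ t θ, L (t + 1) θ = L t θ + e t θ) (T : ℕ)
    (he : ∀ t < T, ∀ θ ∈ alg.Θ, |alg.η * e t θ| ≤ 1) {θ₀ : Vec d} (hθ₀ : θ₀ ∈ alg.Θ) :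
    ∑ t ∈ Finset.range T, (∑ θ ∈ alg.Θ, alg.weight (L t) θ * e t θ - e t θ₀) ≤
      Real.log alg.Θ.card / alg.η +
        alg.η * ∑ t ∈ Finset.range T, ∑ θ ∈ alg.Θ, alg.weight (L t) θ * e t θ ^ 2 := by
  set P : ℕ → ℝ := fun t => ∑ θ ∈ alg.Θ, alg.weight (L t) θ * e t θ
  set Q : ℕ → ℝ := fun t => ∑ θ ∈ alg.Θ, alg.weight (L t) θ * e t θ ^ 2
  have hcard : (0 : ℝ) < alg.Θ.card := by exact_mod_cast h.nonempty.card_pos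
  have key : ∀ n ≤ T, ∑ θ ∈ alg.Θ, Real.exp (-alg.η * L n θ) ≤
      alg.Θ.card * Real.exp (∑ t ∈ Finset.range n, (-alg.η * P t + alg.η ^ 2 * Q t)) := by
    intro n hn
    induction n with
    | zero => simp [hL0]
    | succ n ih =>
      simp only [hL]
      refine (h.sum_exp_add_le (L n) (e n) (he n hn)).trans ?_
      rw [Finset.sum_range_succ, Real.exp_add (∑ t ∈ Finset.range n, _), ← mul_assoc]
      exact mul_le_mul_of_nonneg_right (ih (by omega)) (Real.exp_pos _).le
  have hsum : ∀ n, L n θ₀ = ∑ t ∈ Finset.range n, e t θ₀ := fun n => by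
    induction n with
    | zero => simp [hL0]
    | succ n ih => rw [hL, ih, Finset.sum_range_succ]
  -- The potential dominates its single term at `θ₀`; taking logarithms gives the regret against
  -- `θ₀`.
  have h1 : Real.exp (-alg.η * L T θ₀) ≤
      alg.Θ.card * Real.exp (∑ t ∈ Finset.range T, (-alg.η * P t + alg.η ^ 2 * Q t)) :=
    (Finset.single_le_sum (f := fun θ => Real.exp (-alg.η * L T θ))
      (fun θ _ => (Real.exp_pos _).le) hθ₀).trans (key T le_rfl)
  have h2 := Real.log_le_log (Real.exp_pos _) h1
  rw [Real.log_mul hcard.ne' (Real.exp_pos _).ne', Real.log_exp, Real.log_exp,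
    Finset.sum_add_distrib, ← Finset.mul_sum, ← Finset.mul_sum, hsum] at h2
  rw [Finset.sum_sub_distrib, ← mul_le_mul_iff_right₀ hη, mul_add, mul_div_cancel₀ _ hη.ne']
  nlinarith

end ExponentialWeights

/-! ### From the interaction protocol to single rounds -/

section Run

variable {d : ℕ} {Ω : Type*} [mΩ : MeasurableSpace Ω] {alg : Exp4 d} {T : ℕ} {D : Measure (Ctx d)}
  {μ : Measure Ω} [IsProbabilityMeasure μ] {ctx : ℕ → Ω → Ctx d} {y act : ℕ → Ω → Vec d}
  {loss : ℕ → Ω → ℝ}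

theorem integral_mul_eq_of_condExp_ae_eq {m : MeasurableSpace Ω} (hm : m ≤ mΩ) {f g r : Ω → ℝ}
    (hf : Measurable[m] f) {K : ℝ} (hK : ∀ᵐ ω ∂μ, |f ω| ≤ K) (hg : Integrable g μ)
    (hr : μ[g | m] =ᵐ[μ] r) : ∫ ω, f ω * g ω ∂μ = ∫ ω, f ω * r ω ∂μ := by
  have hfg : Integrable (f * g) μ :=
    hg.bdd_mul (hf.mono hm le_rfl).aestronglyMeasurable hK
  have h1 := condExp_mul_of_stronglyMeasurable_left hf.stronglyMeasurable hfg hg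
  calc ∫ ω, f ω * g ω ∂μ = ∫ ω, (μ[f * g | m]) ω ∂μ := (integral_condExp hm).symm
    _ = ∫ ω, f ω * r ω ∂μ := by
      refine integral_congr_ae ?_
      filter_upwards [h1, hr] with ω h2 h3
      rw [h2, Pi.mul_apply, h3]

theorem measure_inter_eq_of_condExp_ae_eq {m : MeasurableSpace Ω} (hm : m ≤ mΩ)
    {E : Type*} [MeasurableSpace E] {X : Ω → E} (hX : Measurable[mΩ] X)
    {κ : Ω → Measure E} (hκ : ∀ ω, IsProbabilityMeasure (κ ω)) (hκm : Measurable[mΩ] κ)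
    {S : Set E} (hS : MeasurableSet S)
    (h : μ[(X ⁻¹' S).indicator (fun _ => (1 : ℝ)) | m] =ᵐ[μ] fun ω => (κ ω).real S)
    {B : Set Ω} (hB : MeasurableSet[m] B) :
    μ (B ∩ X ⁻¹' S) = ∫⁻ ω in B, κ ω S ∂μ := by
  have hinteg : Integrable ((X ⁻¹' S).indicator (fun _ => (1 : ℝ))) μ :=
    (integrable_const _).indicator (hX hS)
  have h1 : ∫ ω in B, (κ ω).real S ∂μ = μ.real (B ∩ X ⁻¹' S) := by
    rw [← setIntegral_congr_ae (hm B hB) (h.mono fun ω hω _ => hω), setIntegral_condExp hm hinteg hB,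
      integral_indicator (hX hS), Measure.restrict_restrict (hX hS), Set.inter_comm]
    simp
  have hmeas : Measurable[mΩ] fun ω => κ ω S := (Measure.measurable_coe hS).comp hκm
  have h2 : ∫⁻ ω in B, κ ω S ∂μ ≠ ∞ := by
    refine ((lintegral_mono fun ω => (prob_le_one : κ ω S ≤ 1)).trans_lt ?_).ne
    simp
  have h3 : ∫ ω in B, (κ ω).real S ∂μ = (∫⁻ ω in B, κ ω S ∂μ).toReal := by
    simp only [measureReal_def]
    exact integral_toReal hmeas.aemeasurable
      (Filter.Eventually.of_forall fun ω => measure_lt_top _ _)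
  rw [h3, measureReal_def, ENNReal.toReal_eq_toReal_iff' h2 (measure_ne_top _ _)] at h1
  exact h1.symm

omit mΩ in
theorem comap_le_past {s t : ℕ} (hst : s < t) :
    MeasurableSpace.comap (ctx s) inferInstance ⊔ MeasurableSpace.comap (y s) inferInstance ⊔
      MeasurableSpace.comap (act s) inferInstance ⊔ MeasurableSpace.comap (loss s) inferInstance ≤
      past ctx y act loss t :=
  le_iSup (fun s : Fin t => MeasurableSpace.comap (ctx s) inferInstance ⊔
    MeasurableSpace.comap (y s) inferInstance ⊔ MeasurableSpace.comap (act s) inferInstance ⊔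
    MeasurableSpace.comap (loss s) inferInstance) ⟨s, hst⟩

omit mΩ in
theorem past_le_beforeAct (t : ℕ) : past ctx y act loss t ≤ beforeAct ctx y act loss t :=
  le_sup_left.trans le_sup_left

omit mΩ in
theorem measurable_ctx_past {s t : ℕ} (hst : s < t) :
    Measurable[past ctx y act loss t] (ctx s) :=
  measurable_iff_comap_le.2
    ((le_sup_left.trans (le_sup_left.trans le_sup_left)).trans (comap_le_past hst))

omit mΩ in
theorem measurable_act_past {s t : ℕ} (hst : s < t) :
    Measurable[past ctx y act loss t] (act s) :=
  measurable_iff_comap_le.2 ((le_sup_right.trans le_sup_left).trans (comap_le_past hst))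

omit mΩ in
theorem measurable_loss_past {s t : ℕ} (hst : s < t) :
    Measurable[past ctx y act loss t] (loss s) :=
  measurable_iff_comap_le.2 (le_sup_right.trans (comap_le_past hst))

namespace IsRun

variable (hrun : IsRun alg T D μ ctx y act loss)

include hrun

omit [IsProbabilityMeasure μ] in
theorem beforeAct_le (t : ℕ) : beforeAct ctx y act loss t ≤ mΩ := by
  refine sup_le (sup_le (iSup_le fun s => sup_le (sup_le (sup_le ?_ ?_) ?_) ?_) ?_) ?_
  · exact (hrun.measurable_ctx s).comap_le
  · exact (hrun.measurable_y s).comap_le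
  · exact (hrun.measurable_act s).comap_le
  · exact (hrun.measurable_loss s).comap_le
  · exact (hrun.measurable_y t).comap_le
  · exact (hrun.measurable_ctx t).comap_le

omit [IsProbabilityMeasure μ] in
theorem beforeLoss_le (t : ℕ) : beforeLoss ctx y act loss t ≤ mΩ :=
  sup_le (hrun.beforeAct_le t) (hrun.measurable_act t).comap_le

omit [IsProbabilityMeasure μ] in
theorem ctx_subset_ball (hD : ∀ᵐ A : Ctx d ∂D, (A : Set (Vec d)) ⊆ Metric.closedBall 0 1) {t : ℕ}
    (ht : t < T) : ∀ᵐ ω ∂μ, (ctx t ω : Set (Vec d)) ⊆ Metric.closedBall 0 1 := by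
  rw [← hrun.ctx_law t ht] at hD
  exact ae_of_ae_map (hrun.measurable_ctx t).aemeasurable hD

/-- The history enters as the identity map of `Ω`, with `beforeAct` as the σ-algebra on its target.
Measurability in the history then is measurability for `beforeAct`, and no tuple of past
observations has to be built. -/
theorem isRound (h : alg.IsAdmissible)
    (hD : ∀ᵐ A : Ctx d ∂D, (A : Set (Vec d)) ⊆ Metric.closedBall 0 1) {t : ℕ} (ht : t < T) :
    @IsRound d Ω Ω mΩ (beforeAct ctx y act loss t) alg μ id
      (fun ω => alg.cumLoss (fun s => ctx s ω) (fun s => act s ω) (fun s => loss s ω) t)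
      (ctx t) (y t) (act t) (loss t) := by
  have hm := hrun.beforeAct_le t
  have hle := past_le_beforeAct (ctx := ctx) (y := y) (act := act) (loss := loss) t
  have hL : ∀ θ, Measurable[beforeAct ctx y act loss t] fun ω =>
      alg.cumLoss (fun s => ctx s ω) (fun s => act s ω) (fun s => loss s ω) t θ := fun θ =>
    @Exp4.measurable_cumLoss d alg Ω (beforeAct ctx y act loss t) h.greedy ctx act loss t
      (fun s hs => (measurable_ctx_past hs).mono hle le_rfl)
      (fun s hs => (measurable_act_past hs).mono hle le_rfl)
      (fun s hs => (measurable_loss_past hs).mono hle le_rfl) θ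
  have hA : Measurable[beforeAct ctx y act loss t] (ctx t) :=
    measurable_iff_comap_le.2 le_sup_right
  refine @IsRound.mk d Ω Ω mΩ (beforeAct ctx y act loss t) alg μ id _ _ _ _ _ ?_ hL hA ?_
    (hrun.measurable_act t) (hrun.measurable_loss t) (hrun.ctx_subset_ball hD ht)
    (hrun.norm_y_le t ht) (hrun.abs_loss_le t ht) ?_ ?_
  · exact measurable_id.mono hm le_rfl
  · exact measurable_iff_comap_le.2 (le_sup_right.trans le_sup_left)
  · intro B hB S hS
    exact measure_inter_eq_of_condExp_ae_eq hm (hrun.measurable_act t)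
      (κ := fun ω => alg.actionLaw (fun s => ctx s ω) (fun s => act s ω) (fun s => loss s ω) t)
      (fun ω => h.isProbabilityMeasure_law _ _)
      (Exp4.measurable_law h.greedy (fun θ => (hL θ).mono hm le_rfl) (hrun.measurable_ctx t))
      hS (hrun.act_law t ht S hS) hB
  · intro g hg K hK
    have h1 : Measurable[beforeLoss ctx y act loss t, beforeAct ctx y act loss t] (id : Ω → Ω) :=
      measurable_id.mono le_sup_left le_rfl
    have h2 : Measurable[beforeLoss ctx y act loss t] (act t) :=
      measurable_iff_comap_le.2 le_sup_right
    refine integral_mul_eq_of_condExp_ae_eq (hrun.beforeLoss_le t) ?_ hK ?_ (hrun.loss_mean t ht)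
    · exact hg.comp (h1.prodMk h2)
    · exact Integrable.of_bound (hrun.measurable_loss t).aestronglyMeasurable 1
        (hrun.abs_loss_le t ht)

end IsRun

end Run

/-! ### The regret bound -/

section Regret

variable {d : ℕ} {Ω : Type*} [mΩ : MeasurableSpace Ω] {alg : Exp4 d} {T : ℕ} {D : Measure (Ctx d)}
  {μ : Measure Ω} [IsProbabilityMeasure μ] {ctx : ℕ → Ω → Ctx d} {y act : ℕ → Ω → Vec d}
  {loss : ℕ → Ω → ℝ}

theorem Exp4.IsAdmissible.integral_exponential_weights (h : alg.IsAdmissible) (hη : 0 < alg.η)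
    {L e : Ω → ℕ → Vec d → ℝ} (hL0 : ∀ ω θ, L ω 0 θ = 0)
    (hL : ∀ ω t θ, L ω (t + 1) θ = L ω t θ + e ω t θ)
    (hbound : ∀ t < T, ∀ θ, ∀ᵐ ω ∂μ, |e ω t θ| ≤ alg.η⁻¹)
    (hei : ∀ t < T, ∀ θ, Integrable (fun ω => e ω t θ) μ)
    (hwei : ∀ t < T, ∀ θ ∈ alg.Θ, Integrable (fun ω => alg.weight (L ω t) θ * e ω t θ) μ)
    (hwe2 : ∀ t < T, ∀ θ ∈ alg.Θ, Integrable (fun ω => alg.weight (L ω t) θ * e ω t θ ^ 2) μ)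
    {θ₀ : Vec d} (hθ₀ : θ₀ ∈ alg.Θ) :
    ∑ t ∈ Finset.range T,
        ((∫ ω, ∑ θ ∈ alg.Θ, alg.weight (L ω t) θ * e ω t θ ∂μ) - ∫ ω, e ω t θ₀ ∂μ) ≤
      Real.log alg.Θ.card / alg.η + alg.η * ∑ t ∈ Finset.range T,
        ∫ ω, ∑ θ ∈ alg.Θ, alg.weight (L ω t) θ * e ω t θ ^ 2 ∂μ := by
  have hae : ∀ᵐ ω ∂μ, ∑ t ∈ Finset.range T,
      (∑ θ ∈ alg.Θ, alg.weight (L ω t) θ * e ω t θ - e ω t θ₀) ≤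
      Real.log alg.Θ.card / alg.η + alg.η * ∑ t ∈ Finset.range T,
        ∑ θ ∈ alg.Θ, alg.weight (L ω t) θ * e ω t θ ^ 2 := by
    have h1 : ∀ᵐ ω ∂μ, ∀ t ∈ Finset.range T, ∀ θ ∈ alg.Θ, |e ω t θ| ≤ alg.η⁻¹ :=
      (Finset.eventually_all _).2 fun t ht => (Finset.eventually_all _).2 fun θ _ =>
        hbound t (Finset.mem_range.1 ht) θ
    filter_upwards [h1] with ω hω
    refine h.exponential_weights hη (L ω) (e ω) (hL0 ω) (hL ω) T (fun t ht θ hθ => ?_) hθ₀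
    rw [abs_mul, abs_of_pos hη, mul_comm, ← le_div_iff₀ hη, one_div]
    exact hω t (Finset.mem_range.2 ht) θ hθ
  have hi1 : ∀ t ∈ Finset.range T, Integrable (fun ω =>
      ∑ θ ∈ alg.Θ, alg.weight (L ω t) θ * e ω t θ - e ω t θ₀) μ := fun t ht =>
    (integrable_finsetSum _ (hwei t (Finset.mem_range.1 ht))).sub
      (hei t (Finset.mem_range.1 ht) θ₀)
  have hi2 : ∀ t ∈ Finset.range T, Integrable (fun ω =>
      ∑ θ ∈ alg.Θ, alg.weight (L ω t) θ * e ω t θ ^ 2) μ := fun t ht =>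
    integrable_finsetSum _ (hwe2 t (Finset.mem_range.1 ht))
  have hmono := integral_mono_ae (integrable_finsetSum _ hi1)
    ((integrable_const _).add ((integrable_finsetSum _ hi2).const_mul _)) hae
  have hlhs : ∑ t ∈ Finset.range T, ∫ ω,
      (∑ θ ∈ alg.Θ, alg.weight (L ω t) θ * e ω t θ - e ω t θ₀) ∂μ =
      ∑ t ∈ Finset.range T,
        ((∫ ω, ∑ θ ∈ alg.Θ, alg.weight (L ω t) θ * e ω t θ ∂μ) - ∫ ω, e ω t θ₀ ∂μ) := by
    refine Finset.sum_congr rfl fun t ht => ?_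
    have ht' := Finset.mem_range.1 ht
    rw [integral_sub (integrable_finsetSum _ (hwei t ht')) (hei t ht' θ₀)]
  simp only [Pi.add_apply] at hmono
  rwa [integral_finsetSum _ hi1, hlhs,
    integral_add (integrable_const _) ((integrable_finsetSum _ hi2).const_mul _),
    integral_const_mul, integral_finsetSum _ hi2, integral_const, probReal_univ, one_smul]
    at hmono

namespace IsRun

/-- Regret against the policies of linear EXP4. -/
theorem sum_integral_inner_act_le (hrun : IsRun alg T D μ ctx y act loss)
    (h : alg.IsAdmissible) (hη : 0 < alg.η) (hγ : alg.γ = 2 * d * alg.η)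
    (hD : ∀ᵐ A : Ctx d ∂D, (A : Set (Vec d)) ⊆ Metric.closedBall 0 1) {θ₀ : Vec d}
    (hθ₀ : θ₀ ∈ alg.Θ) :
    ∑ t ∈ Finset.range T, ∫ ω, inner ℝ (act t ω) (y t ω) ∂μ ≤
      ∑ t ∈ Finset.range T, ∫ ω, inner ℝ (alg.greedy θ₀ (ctx t ω)) (y t ω) ∂μ +
        (Real.log alg.Θ.card / alg.η + alg.η * (T * d) + T * (2 * alg.γ)) := by
  set L : Ω → ℕ → Vec d → ℝ := fun ω t =>
    alg.cumLoss (fun s => ctx s ω) (fun s => act s ω) (fun s => loss s ω) t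
  set e : Ω → ℕ → Vec d → ℝ := fun ω t θ =>
    alg.lossEst (L ω t) (ctx t ω) (act t ω) (loss t ω) θ
  have hr : ∀ t < T, @IsRound d Ω Ω mΩ (beforeAct ctx y act loss t) alg μ id
      (fun ω => L ω t) (ctx t) (y t) (act t) (loss t) := fun t ht => hrun.isRound h hD ht
  have hγ1 : 0 ≤ 1 - alg.γ := by linarith [h.γ_le]
  -- The choice `γ = 2dη` makes the range of the estimates exactly what exponential weights
  -- tolerate.
  have hK : 2 * d / alg.γ = alg.η⁻¹ := by
    have h0 := h.γ_pos.ne'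
    rw [hγ] at h0 ⊢
    have : (2 * d : ℝ) ≠ 0 := left_ne_zero_of_mul h0
    rw [div_mul_cancel_left₀ this]
  have hebound : ∀ t < T, ∀ θ, ∀ᵐ ω ∂μ, |e ω t θ| ≤ alg.η⁻¹ := fun t ht θ =>
    hK ▸ IsRound.abs_lossEst_le h (hr t ht) θ
  have hmeas : ∀ t < T, ∀ θ, Measurable fun ω => e ω t θ := fun t ht θ =>
    IsRound.measurable_lossEst h (hr t ht) θ
  have hei : ∀ t < T, ∀ θ, Integrable (fun ω => e ω t θ) μ := fun t ht θ =>
    Integrable.of_bound (hmeas t ht θ).aestronglyMeasurable _ (hebound t ht θ)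
  have hwei : ∀ t < T, ∀ θ ∈ alg.Θ, Integrable (fun ω => alg.weight (L ω t) θ * e ω t θ) μ :=
    fun t ht θ hθ => IsRound.integrable_weight_mul_lossEst h (hr t ht) hθ
  have hwe2 : ∀ t < T, ∀ θ ∈ alg.Θ,
      Integrable (fun ω => alg.weight (L ω t) θ * e ω t θ ^ 2) μ :=
    fun t ht θ hθ => IsRound.integrable_weight_mul_lossEst_sq h (hr t ht) hθ
  set W : ℕ → ℝ := fun t => ∫ ω, ∑ θ ∈ alg.Θ, alg.weight (L ω t) θ * e ω t θ ∂μ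
  set Q : ℕ → ℝ := fun t => ∫ ω, ∑ θ ∈ alg.Θ, alg.weight (L ω t) θ * e ω t θ ^ 2 ∂μ
  set G : ℕ → ℝ := fun t => ∫ ω, inner ℝ (alg.greedy θ₀ (ctx t ω)) (y t ω) ∂μ
  have hG : ∀ t < T, ∫ ω, e ω t θ₀ ∂μ = G t := fun t ht => by
    have := IsRound.integral_mul_lossEst h (hr t ht) (p := fun _ => 1) measurable_const
      (by simp) θ₀
    simpa using this
  have hGle : ∀ t < T, -1 ≤ G t := fun t ht => by
    have h1 := norm_integral_le_of_norm_le_const (μ := μ)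
      (f := fun ω => inner ℝ (alg.greedy θ₀ (ctx t ω)) (y t ω)) (C := 1)
      (IsRound.abs_inner_greedy_le h (hr t ht) θ₀)
    rw [probReal_univ, mul_one] at h1
    exact (abs_le.1 h1).1
  have hact : ∀ t < T, ∫ ω, inner ℝ (act t ω) (y t ω) ∂μ ≤ (1 - alg.γ) * W t + alg.γ :=
    fun t ht => IsRound.integral_inner_X_le_lossEst h (hr t ht)
  have hQle : ∀ t < T, (1 - alg.γ) * Q t ≤ d := fun t ht => by
    have := IsRound.integral_weight_mul_lossEst_sq_le h (hr t ht)
    exact this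
  have hpath : ∑ t ∈ Finset.range T, (W t - G t) ≤
      Real.log alg.Θ.card / alg.η + alg.η * ∑ t ∈ Finset.range T, Q t := by
    have h1 := h.integral_exponential_weights hη (L := L) (e := e) (fun _ _ => rfl)
      (fun _ _ _ => rfl) hebound hei hwei hwe2 hθ₀
    rwa [Finset.sum_congr rfl fun t ht => by rw [hG t (Finset.mem_range.1 ht)]] at h1
  have hlog : 0 ≤ Real.log alg.Θ.card / alg.η :=
    div_nonneg (Real.log_nonneg (by exact_mod_cast h.nonempty.card_pos)) hη.le
  have hsum : ∑ t ∈ Finset.range T, (1 - alg.γ) * Q t ≤ T * d := by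
    calc _ ≤ ∑ _t ∈ Finset.range T, (d : ℝ) :=
          Finset.sum_le_sum fun t ht => hQle t (Finset.mem_range.1 ht)
      _ = T * d := by simp
  rw [← Finset.mul_sum] at hsum
  -- Here `(1 - γ) W + γ = G + (1 - γ)(W - G) + γ (1 - G)` with `G ≥ -1`. The factor `1 - γ` is kept
  -- because the variance bound controls only `(1 - γ) Q`.
  have hstep : ∀ t ∈ Finset.range T, ∫ ω, inner ℝ (act t ω) (y t ω) ∂μ ≤
      G t + ((1 - alg.γ) * (W t - G t) + 2 * alg.γ) := by
    intro t ht
    have h1 := hact t (Finset.mem_range.1 ht)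
    have h2 := hGle t (Finset.mem_range.1 ht)
    nlinarith [h.γ_pos]
  calc ∑ t ∈ Finset.range T, ∫ ω, inner ℝ (act t ω) (y t ω) ∂μ
      ≤ ∑ t ∈ Finset.range T, (G t + ((1 - alg.γ) * (W t - G t) + 2 * alg.γ)) :=
        Finset.sum_le_sum hstep
    _ = ∑ t ∈ Finset.range T, G t + ((1 - alg.γ) * ∑ t ∈ Finset.range T, (W t - G t) +
          T * (2 * alg.γ)) := by
        rw [Finset.sum_add_distrib, Finset.sum_add_distrib, Finset.mul_sum]
        simp
    _ ≤ _ := by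
        have h1 := mul_le_mul_of_nonneg_left hpath hγ1
        have h2 := mul_le_mul_of_nonneg_left hsum hη.le
        have h3 : (1 - alg.γ) * (Real.log alg.Θ.card / alg.η) ≤ Real.log alg.Θ.card / alg.η :=
          mul_le_of_le_one_left hlog (by linarith [h.γ_pos])
        rw [mul_add] at h1
        have h4 : (1 - alg.γ) * (alg.η * ∑ t ∈ Finset.range T, Q t) =
          alg.η * ((1 - alg.γ) * ∑ t ∈ Finset.range T, Q t) := by ring
        linarith

omit [IsProbabilityMeasure μ] in
theorem indepFun_ctx_y (hrun : IsRun alg T D μ ctx y act loss) {t : ℕ} (ht : t < T) :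
    IndepFun (ctx t) (y t) μ :=
  (indep_of_indep_of_le_left (hrun.ctx_indep t ht) le_sup_right).symm

/-- A policy is applied to an action set that is independent of the loss vector. -/
theorem integral_inner_policy (hrun : IsRun alg T D μ ctx y act loss) {t : ℕ} (ht : t < T)
    {f : Ctx d → Vec d} (hf : Measurable f) (hf1 : ∀ᵐ A ∂D, ‖f A‖ ≤ 1) :
    ∫ ω, inner ℝ (f (ctx t ω)) (y t ω) ∂μ = ∫ A, inner ℝ (f A) (∫ ω, y t ω ∂μ) ∂D := by
  have hc := hrun.measurable_ctx t
  have hy := hrun.measurable_y t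
  have hmap := (indepFun_iff_map_prod_eq_prod_map_map hc.aemeasurable hy.aemeasurable).1
    (hrun.indepFun_ctx_y ht)
  rw [hrun.ctx_law t ht] at hmap
  have hD : IsProbabilityMeasure D := by
    rw [← hrun.ctx_law t ht]
    exact Measure.isProbabilityMeasure_map hc.aemeasurable
  have := Measure.isProbabilityMeasure_map (μ := μ) hy.aemeasurable
  have hyi : Integrable (y t) μ :=
    Integrable.of_bound hy.aestronglyMeasurable 1 (hrun.norm_y_le t ht)
  have hF : Measurable fun p : Ctx d × Vec d => (inner ℝ (f p.1) p.2 : ℝ) :=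
    (hf.comp measurable_fst).inner measurable_snd
  have hf1' : ∀ᵐ ω ∂μ, ‖f (ctx t ω)‖ ≤ 1 := by
    rw [← hrun.ctx_law t ht] at hf1
    exact ae_of_ae_map hc.aemeasurable hf1
  have hinteg : Integrable (fun p : Ctx d × Vec d => (inner ℝ (f p.1) p.2 : ℝ))
      (μ.map fun ω => (ctx t ω, y t ω)) := by
    refine (integrable_map_measure hF.aestronglyMeasurable (hc.prodMk hy).aemeasurable).2
      (Integrable.of_bound (hF.comp (hc.prodMk hy)).aestronglyMeasurable 1 ?_)
    filter_upwards [hf1', hrun.norm_y_le t ht] with ω h1 h2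
    exact (norm_inner_le_norm _ _).trans (mul_le_one₀ h1 (norm_nonneg _) h2)
  have h1 := integral_map (hc.prodMk hy).aemeasurable (μ := μ) hF.aestronglyMeasurable
  rw [← h1, hmap, integral_prod _ (hmap ▸ hinteg)]
  refine integral_congr_ae (Filter.Eventually.of_forall fun A => ?_)
  dsimp only
  rw [← integral_inner hyi]
  exact integral_map hy.aemeasurable (by fun_prop)

end IsRun

theorem IsGreedy.inner_le_of_mem_convexHull {greedy : Vec d → Ctx d → Vec d} (hg : IsGreedy greedy)
    (θ : Vec d) (A : Ctx d) {b : Vec d} (hb : b ∈ convexHull ℝ (A : Set (Vec d))) :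
    inner ℝ (greedy θ A) θ ≤ inner ℝ b θ := by
  have hconv : Convex ℝ {b : Vec d | inner ℝ (greedy θ A) θ ≤ inner ℝ b θ} :=
    convex_halfSpace_ge ⟨fun x z => inner_add_left x z θ, fun c x => by
      simp [inner_smul_left]⟩ _
  exact convexHull_min (fun b hb => hg.le θ A b hb) hconv hb

/-- A policy that is greedy for a parameter near `Y` is almost optimal for `Y`. -/
theorem IsGreedy.inner_le_add_two {greedy : Vec d → Ctx d → Vec d} (hg : IsGreedy greedy)
    {θ Y : Vec d} (hθ : dist Y θ ≤ 1) {A : Ctx d}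
    (hA : (A : Set (Vec d)) ⊆ Metric.closedBall 0 1) {b : Vec d}
    (hb : b ∈ convexHull ℝ (A : Set (Vec d))) :
    inner ℝ (greedy θ A) Y ≤ inner ℝ b Y + 2 := by
  have hball : ∀ x ∈ convexHull ℝ (A : Set (Vec d)), |inner ℝ x (Y - θ)| ≤ 1 := fun x hx => by
    have hx1 : ‖x‖ ≤ 1 := by simpa using convexHull_min hA (convex_closedBall 0 1) hx
    refine (abs_real_inner_le_norm _ _).trans (mul_le_one₀ hx1 (norm_nonneg _) ?_)
    rwa [← dist_eq_norm]
  -- Exchanging `Y` for `θ` costs `1` at each of the two points compared.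
  have h1 := abs_le.1 (hball _ (subset_convexHull ℝ _ (hg.mem θ A)))
  have h2 := abs_le.1 (hball b hb)
  have h3 := hg.inner_le_of_mem_convexHull θ A hb
  rw [inner_sub_right] at h1 h2
  linarith [h1.2, h2.1]

/-- Some policy of linear EXP4 is almost as good as any given policy. -/
theorem IsRun.exists_greedy_le (hrun : IsRun alg T D μ ctx y act loss) [IsProbabilityMeasure D]
    (hD : ∀ᵐ A : Ctx d ∂D, (A : Set (Vec d)) ⊆ Metric.closedBall 0 1)
    (hg : IsGreedy alg.greedy)
    (hcover : Metric.IsCover 1 (Metric.closedBall (0 : Vec d) T) (alg.Θ : Set (Vec d)))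
    {π : Ctx d → Vec d} (hπ : IsPolicy π) :
    ∃ θ ∈ alg.Θ, ∑ t ∈ Finset.range T, ∫ ω, inner ℝ (alg.greedy θ (ctx t ω)) (y t ω) ∂μ ≤
      ∑ t ∈ Finset.range T, ∫ ω, inner ℝ (π (ctx t ω)) (y t ω) ∂μ + 2 := by
  set Y : Vec d := ∑ t ∈ Finset.range T, ∫ ω, y t ω ∂μ with hY
  have hYT : Y ∈ Metric.closedBall (0 : Vec d) T := by
    rw [mem_closedBall_zero_iff]
    refine (norm_sum_le _ _).trans ((Finset.sum_le_sum fun t ht => ?_).trans_eq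
      (b := ∑ t ∈ Finset.range T, (1 : ℝ)) (by simp))
    have h1 := norm_integral_le_of_norm_le_const (hrun.norm_y_le t (Finset.mem_range.1 ht))
    simpa using h1
  obtain ⟨θ, hθ, hdist⟩ := hcover hYT
  have hdist' : dist Y θ ≤ 1 := by
    have h1 : edist Y θ ≤ ((1 : ℝ≥0) : ℝ≥0∞) := hdist
    rw [edist_nndist, ENNReal.coe_le_coe] at h1
    exact_mod_cast h1
  have hnorm : ∀ f : Ctx d → Vec d, (∀ A : Ctx d, f A ∈ convexHull ℝ (A : Set (Vec d))) →
      ∀ᵐ A ∂D, ‖f A‖ ≤ 1 := fun f hf => by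
    filter_upwards [hD] with A hA
    simpa using convexHull_min hA (convex_closedBall 0 1) (hf A)
  have hi : ∀ f : Ctx d → Vec d, Measurable f →
      (∀ A : Ctx d, f A ∈ convexHull ℝ (A : Set (Vec d))) →
      ∀ z : Vec d, Integrable (fun A => (inner ℝ (f A) z : ℝ)) D := fun f hfm hf z => by
    refine Integrable.of_bound (C := ‖z‖) (hfm.inner measurable_const).aestronglyMeasurable ?_
    filter_upwards [hnorm f hf] with A hA
    exact (norm_inner_le_norm _ _).trans (mul_le_of_le_one_left (norm_nonneg _) hA)
  -- The environment enters the loss of a fixed policy only through `Y`, however adaptive it is.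
  have hsum : ∀ f : Ctx d → Vec d, Measurable f →
      (∀ A : Ctx d, f A ∈ convexHull ℝ (A : Set (Vec d))) →
      ∑ t ∈ Finset.range T, ∫ ω, inner ℝ (f (ctx t ω)) (y t ω) ∂μ = ∫ A, inner ℝ (f A) Y ∂D :=
    fun f hfm hf => by
      rw [Finset.sum_congr rfl fun t ht =>
        hrun.integral_inner_policy (Finset.mem_range.1 ht) hfm (hnorm f hf),
        ← integral_finsetSum _ fun t _ => hi f hfm hf _]
      simp only [hY, inner_sum]
  have hgm : ∀ A : Ctx d, alg.greedy θ A ∈ convexHull ℝ (A : Set (Vec d)) := fun A =>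
    subset_convexHull ℝ _ (hg.mem θ A)
  refine ⟨θ, hθ, ?_⟩
  rw [hsum _ (hg.measurable θ) hgm, hsum _ hπ.measurable hπ.mem_convexHull]
  calc ∫ A, inner ℝ (alg.greedy θ A) Y ∂D ≤ ∫ A, (inner ℝ (π A) Y + 2) ∂D := by
        refine integral_mono_ae (hi _ (hg.measurable θ) hgm Y)
          ((hi _ hπ.measurable hπ.mem_convexHull Y).add (integrable_const _)) ?_
        filter_upwards [hD] with A hA
        exact hg.inner_le_add_two hdist' hA (hπ.mem_convexHull A)
    _ = _ := by
        rw [integral_add (hi _ hπ.measurable hπ.mem_convexHull Y) (integrable_const _)]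
        simp

theorem sqrt_log_div_mul_self {T : ℕ} (hT : 2 ≤ T) :
    √(Real.log T / T) * T = √(T * Real.log T) := by
  have hT0 : (0 : ℝ) < T := by positivity
  have hlog : 0 ≤ Real.log T := Real.log_natCast_nonneg T
  rw [eq_comm, Real.sqrt_eq_iff_mul_self_eq (by positivity) (by positivity)]
  have := Real.mul_self_sqrt (show 0 ≤ Real.log T / T by positivity)
  rw [mul_mul_mul_comm, this]
  field_simp

theorem Exp4.IsTuned.isAdmissible (h : alg.IsTuned T) (hT : 2 ≤ T) (hd : 0 < d) :
    alg.IsAdmissible where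
  nonempty := Finset.coe_nonempty.1 (h.cover.nonempty ⟨0, by simp⟩)
  greedy := h.greedy
  explore := h.explore
  γ_pos := by
    have hT1 : (1 : ℝ) < T := by exact_mod_cast hT
    have hlog := Real.log_pos hT1
    rw [h.γ_eq]
    have hd' : (0 : ℝ) < d := by exact_mod_cast hd
    exact lt_min one_pos (by positivity)
  γ_le := h.γ_eq ▸ min_le_left _ _

theorem IsRun.regret_le (hrun : IsRun alg T D μ ctx y act loss) (hT : 2 ≤ T)
    (h : alg.IsTuned T) [IsProbabilityMeasure D]
    (hD : ∀ᵐ A : Ctx d ∂D, (A : Set (Vec d)) ⊆ Metric.closedBall 0 1)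
    {π : Ctx d → Vec d} (hπ : IsPolicy π) :
    regret T μ ctx y act π ≤ 10 * d * √(T * Real.log T) := by
  -- For `d = 0` the exploration weight is `0`, so the algorithm is not admissible; all inner
  -- products vanish.
  rcases Nat.eq_zero_or_pos d with rfl | hd
  · have h0 : ∀ v w : Vec 0, (inner ℝ v w : ℝ) = 0 := fun v w => by
      rw [Subsingleton.elim v 0, inner_zero_left]
    simp [regret, h0]
  have hadm := h.isAdmissible hT hd
  have hd1 : (1 : ℝ) ≤ d := by exact_mod_cast hd
  have hT2 : (2 : ℝ) ≤ T := by exact_mod_cast hT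
  have hlog : 0 < Real.log T := Real.log_pos (by linarith)
  set S := √(T * Real.log T) with hS
  have hηT : alg.η * T = S := by rw [h.η_eq]; exact sqrt_log_div_mul_self hT
  have hη : 0 < alg.η := by
    rw [h.η_eq]
    exact Real.sqrt_pos.2 (by positivity)
  have hact : ∀ t < T, ∀ᵐ ω ∂μ, |inner ℝ (act t ω) (y t ω)| ≤ 1 := fun t ht =>
    IsRound.abs_inner_X_le hadm (hrun.isRound hadm hD ht)
  have hpol : ∀ t < T, ∀ᵐ ω ∂μ, |inner ℝ (π (ctx t ω)) (y t ω)| ≤ 1 := fun t ht => by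
    filter_upwards [hrun.ctx_subset_ball hD ht, hrun.norm_y_le t ht] with ω h1 h2
    have h3 : ‖π (ctx t ω)‖ ≤ 1 := by
      simpa using convexHull_min h1 (convex_closedBall 0 1) (hπ.mem_convexHull (ctx t ω))
    exact (abs_real_inner_le_norm _ _).trans (mul_le_one₀ h3 (norm_nonneg _) h2)
  have hacti : ∀ t ∈ Finset.range T, Integrable (fun ω => (inner ℝ (act t ω) (y t ω) : ℝ)) μ :=
    fun t ht => Integrable.of_bound
      ((hrun.measurable_act t).inner (hrun.measurable_y t)).aestronglyMeasurable 1
      (hact t (Finset.mem_range.1 ht))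
  have hpoli : ∀ t ∈ Finset.range T, Integrable (fun ω => (inner ℝ (π (ctx t ω)) (y t ω) : ℝ)) μ :=
    fun t ht => Integrable.of_bound
      ((hπ.measurable.comp (hrun.measurable_ctx t)).inner
        (hrun.measurable_y t)).aestronglyMeasurable 1 (hpol t (Finset.mem_range.1 ht))
  have hreg : regret T μ ctx y act π =
      ∑ t ∈ Finset.range T, ∫ ω, inner ℝ (act t ω) (y t ω) ∂μ -
        ∑ t ∈ Finset.range T, ∫ ω, inner ℝ (π (ctx t ω)) (y t ω) ∂μ := by
    rw [regret, integral_sub (integrable_finsetSum _ hacti) (integrable_finsetSum _ hpoli),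
      integral_finsetSum _ hacti, integral_finsetSum _ hpoli]
  have hSnn : 0 ≤ S := Real.sqrt_nonneg _
  -- If the cap on `γ` is active, then `T ≤ 2 d η T = 2 d S`, and the trivial regret bound `2T` is
  -- at most `4 d S`.
  rcases le_or_gt 1 (2 * d * alg.η) with hcase | hcase
  · have hbound : ∀ f : Ω → ℝ, (∀ᵐ ω ∂μ, |f ω| ≤ 1) → |∫ ω, f ω ∂μ| ≤ 1 := fun f hf => by
      have := norm_integral_le_of_norm_le_const (μ := μ) (f := f) (C := 1) hf
      simpa using this
    have h1 : regret T μ ctx y act π ≤ ∑ t ∈ Finset.range T, (2 : ℝ) := by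
      rw [hreg, ← Finset.sum_sub_distrib]
      refine Finset.sum_le_sum fun t ht => ?_
      have h2 := abs_le.1 (hbound _ (hact t (Finset.mem_range.1 ht)))
      have h3 := abs_le.1 (hbound _ (hpol t (Finset.mem_range.1 ht)))
      linarith [h2.2, h3.1]
    have h2 : (T : ℝ) ≤ 2 * d * S := by
      rw [← hηT, ← mul_assoc]
      exact le_mul_of_one_le_left (by positivity) hcase
    simp only [Finset.sum_const, Finset.card_range, nsmul_eq_mul] at h1
    nlinarith [mul_nonneg (show (0 : ℝ) ≤ d by linarith) hSnn]
  · have hγ : alg.γ = 2 * d * alg.η := by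
      rw [h.γ_eq, ← h.η_eq, min_eq_right hcase.le]
    obtain ⟨θ, hθ, hle⟩ := hrun.exists_greedy_le hD h.greedy h.cover hπ
    have hmain := hrun.sum_integral_inner_act_le hadm hη hγ hD hθ
    have hlogΘ : Real.log alg.Θ.card / alg.η ≤ 3 * d * S := by
      have hcard : (0 : ℝ) < alg.Θ.card := by exact_mod_cast hadm.nonempty.card_pos
      have h1 : Real.log alg.Θ.card ≤ Real.log ((3 * T) ^ d) :=
        Real.log_le_log hcard (by exact_mod_cast h.card_le)
      -- The cube is needed at `T = 2`, where `3T ≤ T²` fails.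
      have h2 : Real.log (3 * T) ≤ 3 * Real.log T := by
        have h3 : Real.log (3 * T) ≤ Real.log ((T : ℝ) ^ 3) :=
          Real.log_le_log (by positivity) (by
            nlinarith [mul_nonneg (show (0 : ℝ) ≤ T by linarith)
              (show (0 : ℝ) ≤ T - 2 by linarith)])
        rw [Real.log_pow] at h3
        exact_mod_cast h3
      have h4 : Real.log T = alg.η * S := by
        rw [← hηT, h.η_eq, ← mul_assoc, Real.mul_self_sqrt (by positivity)]
        field_simp
      rw [Real.log_pow] at h1
      rw [div_le_iff₀ hη]
      calc _ ≤ d * Real.log (3 * T) := h1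
        _ ≤ d * (3 * Real.log T) := mul_le_mul_of_nonneg_left h2 (by linarith)
        _ = 3 * d * S * alg.η := by rw [h4]; ring
    -- This absorbs the discretization loss `2` into `2 d S`, so the constant is `3 + 1 + 4 + 2 =
    -- 10`.
    have hS1 : 1 ≤ S := by
      rw [hS, Real.one_le_sqrt]
      have h2 : Real.log 2 ≤ Real.log T := Real.log_le_log (by norm_num) hT2
      nlinarith [Real.log_two_gt_d9]
    have h5 : alg.η * (T * d) = d * S := by rw [← hηT]; ring
    have h6 : T * (2 * alg.γ) = 4 * d * S := by rw [hγ, ← hηT]; ring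
    have h7 : (1 : ℝ) ≤ d * S := one_le_mul_of_one_le_of_one_le hd1 hS1
    rw [hreg]
    linarith

end Regret

end LinCB

end

theorem mainTheorem3 :
    (∀ d T : ℕ, 1 ≤ T → ∃ Θ : Finset (LinCB.Vec d),
      Metric.IsCover 1 (Metric.closedBall (0 : LinCB.Vec d) T) (Θ : Set (LinCB.Vec d)) ∧
        Θ.card ≤ (3 * T) ^ d) ∧
    ∃ C : ℝ, 0 < C ∧
      ∀ (d T : ℕ), 2 ≤ T →
      ∀ alg : LinCB.Exp4 d, alg.IsTuned T →
      ∀ D : Measure (LinCB.Ctx d), IsProbabilityMeasure D →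
        (∀ᵐ A : LinCB.Ctx d ∂D, (A : Set (LinCB.Vec d)) ⊆ Metric.closedBall 0 1) →
      ∀ (Ω : Type*) [MeasurableSpace Ω] (μ : Measure Ω) [IsProbabilityMeasure μ]
        (ctx : ℕ → Ω → LinCB.Ctx d) (y act : ℕ → Ω → LinCB.Vec d) (loss : ℕ → Ω → ℝ),
        LinCB.IsRun alg T D μ ctx y act loss →
      ∀ π : LinCB.Ctx d → LinCB.Vec d, LinCB.IsPolicy π →
        LinCB.regret T μ ctx y act π ≤ C * d * √(T * Real.log T) := by
  refine ⟨LinCB.exists_isCover_closedBall, 10, by norm_num, ?_⟩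
  intro d T hT alg halg D _ hD Ω _ μ _ ctx y act loss hrun π hπ
  exact hrun.regret_le hT halg hD hπ
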